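/- **Setting.** Let $(X^{(0)},X^{(1)},Y)$ be random with joint law $\mathbb P$ on $\mathcal X^{(0)}\times\mathcal X^{(1)}\times\{0,1\}$, and suppose that $X^{(0)}$ and $X^{(1)}$ are conditionally independent given $Y$. Let $\hat Y:\mathcal X^{(0)}\to\{0,1,\varnothing\}$ be a measurable label model ($\varnothing$ means abstention), and let $\mathcal F$ be a class of measurable classifiers $f:\mathcal X^{(1)}\to\{0,1\}$ of finite VC dimension $\mathrm{VC}(\mathcal F)$. As usual in uniform convergence, assume the following measurability of $\mathcal F$ (automatic if $\mathcal F$ is countable): for all $k$ and $c\in\{0,1\}^k$ the set $\{x\in(\mathcal X^{(1)})^k:\exists f\in\mathcal F\ \forall i\ f(x_i)=c_i\}$ is measurable up to null sets of the $k$-fold product of the law of $X^{(1)}$. Write $$\mathrm{err}_{bal}(f,Y)=\tfrac12\big(\mathbb P[f(X^{(1)})=0\mid Y=1]+\mathbb P[f(X^{(1)})=1\mid Y=0]\big).$$ **Subset selection with a reference sample.** A scoring rule assigns to every finite sample of pseudolabeled points $(v_i,\hat y_i)\in\mathcal X^{(0)}\times\{0,1,\varnothing\}$ a real score for each of its points (lower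 is better), measurably in the sample. An example is the cut statistic with a measurable representation $\phi:\mathcal X^{(0)}\to\mathbb R^D$ and $K\in\mathbb N$: on the symmetrized $K$-nearest-neighbor graph, in $\phi$, of the points with $\hat y_i\neq\varnothing$ (ties in distance broken by index), with edge weights $w_{ij}=(1+\|\phi(v_i)-\phi(v_j)\|_2)^{-1}$, the score of $i$ is $Z_i=(J_i-\mu_i)/\sigma_i$ (read as $0$ if $\sigma_i=0$), where $J_i=\sum_{j\in N(i)}w_{ij}\mathbb 1[\hat y_i\ne\hat y_j]$, $\mu_i=(1-p_i)\sum_{j\in N(i)}w_{ij}$, $\sigma_i^2=p_i(1-p_i)\sum_{j\in N(i)}w_{ij}^2$, and $p_i$ is the fraction of the points with $\hat y_j\neq\varnothing$ that have $\hat y_j=\hat y_i$. Let a scoring rule, $\beta\in(0,1]$ and a reference sample $\bar{\mathcal R}=(r_1,\dots,r_m)$ in $\mathcal X^{(0)}\times\mathcal X^{(1)}$, drawn independently of the training sample, be given. For $x\in\mathcal X^{(0)}$ let $\mathcal S(x)$ be the score of $x$ when $x$ alone, with pseudolabel $\hat Y(x)$, is inserted into the reference sample (pseudolabeled by $\hat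 Y$, using only first views). Let $\tau_\beta$ be a $100\beta$-percentile of the scores of the covered reference points, computed within the reference sample: if $M$ reference points are covered ($\hat Y\ne\varnothing$), then at most $\beta M$ of them have score $<\tau_\beta$ and at least $\lfloor\beta M\rfloor$ of them have score $\le\tau_\beta$. The refined label model is $\tilde Y(x)=\hat Y(x)$ if $\mathcal S(x)\le\tau_\beta$, and $\tilde Y(x)=\varnothing$ otherwise. Put $$\tilde\alpha=\mathbb P[Y=0\mid\tilde Y(X^{(0)})=1],\qquad \tilde\gamma=\mathbb P[Y=1\mid\tilde Y(X^{(0)})=0].$$ **Statement.** There is a universal constant $C>0$ such that the following holds in every such setting, for every scoring rule (in particular for the cut statistic), every realization of the reference sample (so that $\tilde Y$ is fixed and the probabilities below are conditional on $\bar{\mathcal R}$) and every $n\ge1$. Let $(x_i^{(0)},x_i^{(1)})$, $i=1,\dots,n$, be i.i.d. from the law of $(X^{(0)},X^{(1)})$. 1. The refined sample $\{(x_i^{(0)},x_i^{(1)},\tilde Y(x_i^{(0)}))\}_{i=1}^n$ is i.i.d., with the law of $(X^{(0)},X^{(1)},\tilde Y(X^{(0)}))$. 2. If $\mathbb P[\tilde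 Y=y]>0$ for $y\in\{0,1\}$ and $\tilde\alpha+\tilde\gamma<1$, then for every $\delta\in(0,1)$, with probability at least $1-\delta$ over the sampling of the refined sample, every minimizer $\hat f$ over $\mathcal F$ of the empirical balanced error $$\tfrac12\left(\frac{\sum_i\mathbb 1[f(x_i^{(1)})=0]\,\mathbb 1[\tilde Y(x_i^{(0)})=1]}{\sum_i\mathbb 1[\tilde Y(x_i^{(0)})=1]}+\frac{\sum_i\mathbb 1[f(x_i^{(1)})=1]\,\mathbb 1[\tilde Y(x_i^{(0)})=0]}{\sum_i\mathbb 1[\tilde Y(x_i^{(0)})=0]}\right)$$ (with $0/0=0$) satisfies $$\mathrm{err}_{bal}(\hat f,Y)-\inf_{f\in\mathcal F}\mathrm{err}_{bal}(f,Y)\le\frac{C}{1-\tilde\alpha-\tilde\gamma}\sqrt{\frac{\mathrm{VC}(\mathcal F)\log(n+1)+\log\frac1\delta}{n\,\mathbb P[\tilde Y\ne\varnothing]\,\min_{y\in\{0,1\}}\mathbb P[\tilde Y=y\mid\tilde Y\ne\varnothing]}}.$$ -/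

import Mathlib

open MeasureTheory ProbabilityTheory

universe u v

/-! ### Labels and label models -/

/-- Pseudolabels: `some false` is the label `0`, `some true` is the label `1`, `none` is the
abstention symbol. True labels are elements of `Bool`. -/
abbrev Pseudolabel := Option Bool

instance Pseudolabel.measurableSpace : MeasurableSpace Pseudolabel := ⊤

/-! ### Scoring rules and the cut statistic -/

/-- A rule that assigns a real score (lower is better) to every point of a finite pseudolabeled
sample. The score of a point may depend on the whole sample it belongs to. -/
structure ScoringRule (X₀ : Type*) [MeasurableSpace X₀] where
  score : (N : ℕ) → (Fin N → X₀ × Pseudolabel) → Fin N → ℝ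
  measurable_score : ∀ (N : ℕ) (i : Fin N), Measurable fun v => score N v i

namespace CutStatistic

noncomputable section

variable {X₀ : Type*} {D N : ℕ} (φ : X₀ → EuclideanSpace ℝ (Fin D)) (K : ℕ)
  (v : Fin N → X₀ × Pseudolabel)

/-- The covered points of a sample: those whose pseudolabel is not the abstention symbol. -/
def covered : Finset (Fin N) := {i | (v i).2 ≠ none}

/-- Distance of two sample points in the representation `φ`. -/
def repDist (i j : Fin N) : ℝ := ‖φ (v i).1 - φ (v j).1‖

/-- `l` comes before `j` when points are sorted by distance to `i`, ties broken by index. -/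
def Closer (i l j : Fin N) : Prop :=
  repDist φ v i l < repDist φ v i j ∨ (repDist φ v i l = repDist φ v i j ∧ l < j)

open Classical in
/-- `j` is one of the `K` nearest neighbors of `i` among the other covered points. -/
def IsNN (i j : Fin N) : Prop :=
  j ∈ covered v ∧ j ≠ i ∧ ((covered v).filter fun l => l ≠ i ∧ Closer φ v i l j).card < K

/-- Edges of the (symmetrized) `K`-nearest-neighbor graph on the covered points. -/
def Adj (i j : Fin N) : Prop :=
  i ∈ covered v ∧ j ∈ covered v ∧ (IsNN φ K v i j ∨ IsNN φ K v j i)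

open Classical in
/-- The neighbors of `i` in the graph. -/
def nbrs (i : Fin N) : Finset (Fin N) := {j | Adj φ K v i j}

/-- Edge weights. -/
def weight (i j : Fin N) : ℝ := (1 + repDist φ v i j)⁻¹

/-- The total weight of the cut edges at `i`. -/
def cutWeight (i : Fin N) : ℝ :=
  ∑ j ∈ nbrs φ K v i, weight φ v i j * (if (v i).2 ≠ (v j).2 then 1 else 0)

/-- Fraction of the covered points that carry the same pseudolabel as `i`. -/
def labelFreq (i : Fin N) : ℝ :=
  (((covered v).filter fun j => (v j).2 = (v i).2).card : ℝ) / ((covered v).card : ℝ)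

/-- Mean of the cut weight under the null hypothesis. -/
def nullMean (i : Fin N) : ℝ := (1 - labelFreq v i) * ∑ j ∈ nbrs φ K v i, weight φ v i j

/-- Variance of the cut weight under the null hypothesis. -/
def nullVar (i : Fin N) : ℝ :=
  labelFreq v i * (1 - labelFreq v i) * ∑ j ∈ nbrs φ K v i, weight φ v i j ^ 2

/-- The cut statistic: the Z-score of the cut weight. (If the null variance of a covered point is zero, then its
cut weight equals the null mean, and the score is `0`.) -/
def zScore (i : Fin N) : ℝ :=
  (cutWeight φ K v i - nullMean φ K v i) / √(nullVar φ K v i)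

section Measurability

variable [MeasurableSpace X₀] {φ}

theorem measurable_label (i : Fin N) :
    Measurable fun v : Fin N → X₀ × Pseudolabel => (v i).2 :=
  measurable_snd.comp (measurable_pi_apply i)

theorem measurableSet_covered (i : Fin N) :
    MeasurableSet {v : Fin N → X₀ × Pseudolabel | i ∈ covered v} := by
  have : {v : Fin N → X₀ × Pseudolabel | i ∈ covered v} =
      (fun v : Fin N → X₀ × Pseudolabel => (v i).2) ⁻¹' {none}ᶜ := by
    ext v; simp [covered]
  rw [this]
  exact measurable_label i trivial

theorem measurableSet_sameLabel (i j : Fin N) :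
    MeasurableSet {v : Fin N → X₀ × Pseudolabel | (v i).2 = (v j).2} := by
  have : {v : Fin N → X₀ × Pseudolabel | (v i).2 = (v j).2} =
      ⋃ c : Pseudolabel, (fun v : Fin N → X₀ × Pseudolabel => (v i).2) ⁻¹' {c} ∩
        (fun v : Fin N → X₀ × Pseudolabel => (v j).2) ⁻¹' {c} := by
    ext v; simp [eq_comm]
  rw [this]
  exact MeasurableSet.iUnion fun c =>
    (measurable_label i trivial).inter (measurable_label j trivial)

theorem measurable_repDist (hφ : Measurable φ) (i j : Fin N) :
    Measurable fun v : Fin N → X₀ × Pseudolabel => repDist φ v i j :=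
  ((hφ.comp (measurable_fst.comp (measurable_pi_apply i))).sub
    (hφ.comp (measurable_fst.comp (measurable_pi_apply j)))).norm

theorem measurableSet_closer (hφ : Measurable φ) (i l j : Fin N) :
    MeasurableSet {v : Fin N → X₀ × Pseudolabel | Closer φ v i l j} :=
  (measurableSet_lt (measurable_repDist hφ i l) (measurable_repDist hφ i j)).union
    ((measurableSet_eq_fun (measurable_repDist hφ i l) (measurable_repDist hφ i j)).inter
      (MeasurableSet.const _))

open Classical in
theorem measurable_card_filter {Ω : Type*} [MeasurableSpace Ω] {p q : Ω → Fin N → Prop}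
    (s : Ω → Finset (Fin N)) (hs : ∀ v j, j ∈ s v ↔ p v j)
    (hp : ∀ j, MeasurableSet {v | p v j}) (hq : ∀ j, MeasurableSet {v | q v j}) :
    Measurable fun v => ((s v).filter (q v)).card := by
  have : (fun v => ((s v).filter (q v)).card) =
      fun v => ∑ j, if p v j ∧ q v j then 1 else 0 := by
    funext v
    rw [Finset.sum_boole]
    simp only [Nat.cast_id]
    congr 1
    ext j
    simp [hs]
  rw [this]
  exact Finset.measurable_sum _ fun j _ =>
    Measurable.ite ((hp j).inter (hq j)) measurable_const measurable_const

theorem measurableSet_isNN (hφ : Measurable φ) (i j : Fin N) :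
    MeasurableSet {v : Fin N → X₀ × Pseudolabel | IsNN φ K v i j} := by
  classical
  refine (measurableSet_covered j).inter ((MeasurableSet.const _).inter ?_)
  refine measurableSet_lt (α := ℕ) ?_ measurable_const
  have := measurable_card_filter (Ω := Fin N → X₀ × Pseudolabel)
    (p := fun v l => l ∈ covered v) (q := fun v l => l ≠ i ∧ Closer φ v i l j)
    (fun v => covered v) (fun _ _ => Iff.rfl) measurableSet_covered
    fun l => (MeasurableSet.const _).inter (measurableSet_closer hφ i l j)
  convert this

theorem measurableSet_adj (hφ : Measurable φ) (i j : Fin N) :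
    MeasurableSet {v : Fin N → X₀ × Pseudolabel | Adj φ K v i j} :=
  (measurableSet_covered i).inter ((measurableSet_covered j).inter
    ((measurableSet_isNN K hφ i j).union (measurableSet_isNN K hφ j i)))

theorem measurable_sum_nbrs (hφ : Measurable φ) (i : Fin N)
    {g : (Fin N → X₀ × Pseudolabel) → Fin N → ℝ} (hg : ∀ j, Measurable fun v => g v j) :
    Measurable fun v => ∑ j ∈ nbrs φ K v i, g v j := by
  classical
  have : (fun v => ∑ j ∈ nbrs φ K v i, g v j) =
      fun v => ∑ j, if Adj φ K v i j then g v j else 0 := by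
    funext v
    rw [← Finset.sum_filter]
    rfl
  rw [this]
  exact Finset.measurable_sum _ fun j _ =>
    Measurable.ite (measurableSet_adj K hφ i j) (hg j) measurable_const

theorem measurable_weight (hφ : Measurable φ) (i j : Fin N) :
    Measurable fun v : Fin N → X₀ × Pseudolabel => weight φ v i j :=
  (measurable_const.add (measurable_repDist hφ i j)).inv

theorem measurable_labelFreq (i : Fin N) :
    Measurable fun v : Fin N → X₀ × Pseudolabel => labelFreq v i := by
  classical
  refine Measurable.div ?_ ?_
  · refine (measurable_from_nat (f := fun n : ℕ => (n : ℝ))).comp ?_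
    have := measurable_card_filter (Ω := Fin N → X₀ × Pseudolabel)
      (p := fun v l => l ∈ covered v) (q := fun v j => (v j).2 = (v i).2) (fun v => covered v)
      (fun _ _ => Iff.rfl) measurableSet_covered fun j => measurableSet_sameLabel j i
    convert this
  · refine (measurable_from_nat (f := fun n : ℕ => (n : ℝ))).comp ?_
    have := measurable_card_filter (Ω := Fin N → X₀ × Pseudolabel)
      (p := fun v l => l ∈ covered v) (q := fun _ _ => True) (fun v => covered v)
      (fun _ _ => Iff.rfl) measurableSet_covered fun _ => MeasurableSet.const _
    simpa using this

theorem measurable_zScore (hφ : Measurable φ) (i : Fin N) :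
    Measurable fun v : Fin N → X₀ × Pseudolabel => zScore φ K v i := by
  have h1 := measurable_labelFreq (X₀ := X₀) i
  refine Measurable.div (Measurable.sub ?_ ?_) (Measurable.sqrt ?_)
  · refine measurable_sum_nbrs K hφ i fun j => (measurable_weight hφ i j).mul ?_
    exact Measurable.ite (measurableSet_sameLabel i j).compl measurable_const measurable_const
  · exact (measurable_const.sub h1).mul
      (measurable_sum_nbrs K hφ i fun j => measurable_weight hφ i j)
  · exact (h1.mul (measurable_const.sub h1)).mul
      (measurable_sum_nbrs K hφ i fun j => (measurable_weight hφ i j).pow_const 2)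

end Measurability

end

end CutStatistic

/-- The cut statistic, with representation `φ` and `K` nearest neighbors, as a scoring rule. -/
noncomputable def cutStatistic {X₀ : Type*} [MeasurableSpace X₀] {D : ℕ}
    (φ : X₀ → EuclideanSpace ℝ (Fin D)) (hφ : Measurable φ) (K : ℕ) : ScoringRule X₀ where
  score _ v i := CutStatistic.zScore φ K v i
  measurable_score _ i := CutStatistic.measurable_zScore K hφ i

noncomputable section

/-! ### Refined pseudolabels from a reference sample -/

section Refinement

variable {X₀ X₁ : Type*} [MeasurableSpace X₀] (S : ScoringRule X₀) (Yhat : X₀ → Pseudolabel)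
  {m : ℕ} (r : Fin m → X₀ × X₁)

/-- The score of the reference point `r j`, computed over the reference sample. -/
def referenceScore (j : Fin m) : ℝ :=
  S.score m (fun i => ((r i).1, Yhat (r i).1)) j

/-- The score of a new point `x`, computed after inserting `x` alone into the reference
sample. -/
def insertedScore (x : X₀) : ℝ :=
  S.score (m + 1) (Fin.cons (x, Yhat x) fun i => ((r i).1, Yhat (r i).1)) 0

/-- `τ` is a threshold at the `100 β` percentile of the scores of the `M` covered reference
points: at most `β M` of them score below `τ`, and the number of those that score at most `τ` is
at least `β M` rounded down. (This allows for every way of rounding `β M` to an integer, and the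
number of points with score at most `τ` is then `β M`, up to rounding and ties.) -/
def IsPercentileThreshold (β τ : ℝ) : Prop :=
  ((Finset.univ.filter fun j => Yhat (r j).1 ≠ none ∧ referenceScore S Yhat r j < τ).card : ℝ) ≤
      β * ((Finset.univ.filter fun j => Yhat (r j).1 ≠ none).card : ℝ) ∧
    β * ((Finset.univ.filter fun j => Yhat (r j).1 ≠ none).card : ℝ) <
      ((Finset.univ.filter fun j => Yhat (r j).1 ≠ none ∧ referenceScore S Yhat r j ≤ τ).card : ℝ)
        + 1

/-- The refined label model: keep the pseudolabel of `x` if the score of `x` is at most `τ`,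
abstain otherwise. -/
def refinedLabel (τ : ℝ) (x : X₀) : Pseudolabel :=
  if insertedScore S Yhat r x ≤ τ then Yhat x else none

end Refinement

/-! ### Hypothesis classes -/

/-- The class `F` shatters the finite set `A`. -/
def ShattersSet {X : Type*} (F : Set (X → Bool)) (A : Finset X) : Prop :=
  ∀ g : X → Bool, ∃ f ∈ F, ∀ x ∈ A, f x = g x

/-- The Vapnik-Chervonenkis dimension of a class of `{0,1}`-valued functions. -/
def vcDimension {X : Type*} (F : Set (X → Bool)) : ℕ∞ :=
  ⨆ (A : Finset X) (_ : ShattersSet F A), (A.card : ℕ∞)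

/-- The measurability that is needed for uniform convergence over an uncountable class: the
members of `F` are measurable, and so is, up to null sets of the product of the law `Q`, the set
of all samples on which a given labeling is realized by a member of `F`. Every countable class of
measurable functions has this property. -/
def MeasurableClass {X : Type*} [MeasurableSpace X] (Q : Measure X) (F : Set (X → Bool)) : Prop :=
  (∀ f ∈ F, Measurable f) ∧
    ∀ (k : ℕ) (c : Fin k → Bool),
      NullMeasurableSet {x : Fin k → X | ∃ f ∈ F, ∀ i, f (x i) = c i} (Measure.pi fun _ => Q)

/-! ### Errors -/

section Errors

variable {X₀ X₁ : Type*} [MeasurableSpace X₀] [MeasurableSpace X₁]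

/-- The two views are conditionally independent given the true label, where `P` is the joint law
of `((X⁽⁰⁾, X⁽¹⁾), Y)`. -/
def CondIndepViews (P : Measure ((X₀ × X₁) × Bool)) : Prop :=
  ∀ (y : Bool) (A : Set X₀) (B : Set X₁), MeasurableSet A → MeasurableSet B →
    P[{z | z.1.1 ∈ A ∧ z.1.2 ∈ B} | {z | z.2 = y}] =
      P[{z | z.1.1 ∈ A} | {z | z.2 = y}] * P[{z | z.1.2 ∈ B} | {z | z.2 = y}]

/-- `P[Y = y' | Yt = y]`. With `y' = 0, y = 1` and `y' = 1, y = 0` these are the two error rates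
of the label model `Yt`. -/
def labelErrorRate (P : Measure ((X₀ × X₁) × Bool)) (Yt : X₀ → Pseudolabel) (y' y : Bool) : ℝ :=
  (P[{z | z.2 = y'} | {z | Yt z.1.1 = some y}]).toReal

/-- `P[Yt ≠ ∅]`. -/
def coverage (P : Measure ((X₀ × X₁) × Bool)) (Yt : X₀ → Pseudolabel) : ℝ :=
  (P {z | Yt z.1.1 ≠ none}).toReal

/-- `P[Yt = y | Yt ≠ ∅]`. -/
def coveredClassProb (P : Measure ((X₀ × X₁) × Bool)) (Yt : X₀ → Pseudolabel) (y : Bool) : ℝ :=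
  (P[{z | Yt z.1.1 = some y} | {z | Yt z.1.1 ≠ none}]).toReal

/-- The balanced error of `f` on the true labels. -/
def balancedError (P : Measure ((X₀ × X₁) × Bool)) (f : X₁ → Bool) : ℝ :=
  ((P[{z | f z.1.2 = false} | {z | z.2 = true}]).toReal +
    (P[{z | f z.1.2 = true} | {z | z.2 = false}]).toReal) / 2

/-- The empirical balanced error of `f` on the sample `s`, pseudolabeled by `Yt`. -/
def empBalancedError {n : ℕ} (Yt : X₀ → Pseudolabel) (s : Fin n → X₀ × X₁) (f : X₁ → Bool) : ℝ :=
  ((∑ i, if f (s i).2 = false ∧ Yt (s i).1 = some true then (1 : ℝ) else 0) /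
      (∑ i, if Yt (s i).1 = some true then (1 : ℝ) else 0) +
    (∑ i, if f (s i).2 = true ∧ Yt (s i).1 = some false then (1 : ℝ) else 0) /
      (∑ i, if Yt (s i).1 = some false then (1 : ℝ) else 0)) / 2

/-- `f` minimizes the empirical balanced error over the class `F`. -/
def IsEmpMinimizer {n : ℕ} (F : Set (X₁ → Bool)) (Yt : X₀ → Pseudolabel)
    (s : Fin n → X₀ × X₁) (f : X₁ → Bool) : Prop :=
  f ∈ F ∧ ∀ g ∈ F, empBalancedError Yt s f ≤ empBalancedError Yt s g

/-- The bound on the excess balanced error, up to the constant factor: `Yt` is the label model,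
`d` the VC dimension, `n` the sample size. -/
def excessRiskRate (P : Measure ((X₀ × X₁) × Bool)) (Yt : X₀ → Pseudolabel) (d n : ℕ) (δ : ℝ) :
    ℝ :=
  1 / (1 - labelErrorRate P Yt false true - labelErrorRate P Yt true false) *
    √((d * Real.log (n + 1) + Real.log (1 / δ)) /
      (n * coverage P Yt * min (coveredClassProb P Yt false) (coveredClassProb P Yt true)))

/-- What is claimed about subset selection with the scoring rule `S`, with constant `C`. The
training points are drawn independently from the marginal law `P.fst` of the two views; the
reference sample `r` is arbitrary and fixed. First, the refined training sample is i.i.d.; second,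
except with probability at most `δ`, every empirical minimizer satisfies the bound. -/
def SelectionGuarantee (C : ℝ) (P : Measure ((X₀ × X₁) × Bool)) (F : Set (X₁ → Bool))
    (Yhat : X₀ → Pseudolabel) (S : ScoringRule X₀) : Prop :=
  ∀ (m : ℕ) (r : Fin m → X₀ × X₁) (β τ : ℝ), 0 < β → β ≤ 1 →
    IsPercentileThreshold S Yhat r β τ →
    ∀ (n : ℕ) (_ : 0 < n) (Yt : X₀ → Pseudolabel), Yt = refinedLabel S Yhat r τ →
      (iIndepFun (fun (i : Fin n) (s : Fin n → X₀ × X₁) => (s i, Yt (s i).1))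
          (Measure.pi fun _ => P.fst) ∧
        ∀ i : Fin n, (Measure.pi fun _ : Fin n => P.fst).map (fun s => (s i, Yt (s i).1)) =
          P.fst.map fun x => (x, Yt x.1)) ∧
      ((∀ y : Bool, 0 < P {z | Yt z.1.1 = some y}) →
        labelErrorRate P Yt false true + labelErrorRate P Yt true false < 1 →
        ∀ δ : ℝ, 0 < δ → δ < 1 →
          (Measure.pi fun _ : Fin n => P.fst)
            {s | ∃ f, IsEmpMinimizer F Yt s f ∧
              C * excessRiskRate P Yt (vcDimension F).toNat n δ <
                balancedError P f - ⨅ g : F, balancedError P g} ≤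
          ENNReal.ofReal δ)

end Errors

end

/-! For a fixed reference sample the refined label model is a fixed measurable function of the first
view. The refined sample is therefore i.i.d., and what remains is a question about label noise and
one about uniform convergence.

Noise: given the true label, the pseudolabel and the prediction of `f` are independent. Hence the
error of `f` on pseudolabel 1 mixes its behaviour on `Y = 1` and on `Y = 0` with weights `1 - α` and
`α`, and on pseudolabel 0 likewise with `γ`. In the balanced average these mixtures collapse to an
affine function of the true balanced error with slope `1 - α - γ` (`pseudoBalancedError_eq`). Excess
risk is thus excess pseudolabel risk divided by the slope.

Uniform convergence: the empirical error is a sum of two ratios of counts, and the class `y` has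
only about `q = n * P[Yt = y]` sample points. The counts must therefore be controlled at scale `√(q
* L)` instead of `√(n * L)`, where `L` is `complexity`. A ghost sample
(`measure_deviation_le_two_mul`), random swaps within pairs and the Sauer-Shelah bound
(`card_traces_le`) reduce this to Rademacher sums. Their variance proxy is the number of points of
the class in the double sample (`sum_traceDiff_sq_le`), whose exponential moment is governed by its
mean (`integral_exp_doubleCount_le`). This yields `measure_uniform_deviation_le`; `abs_div_sub_le`
passes from counts to ratios. If `q` is too small for this, the claimed bound exceeds 1 and is
trivial. -/

/-! ### Growth function of a class of finite VC dimension -/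

theorem sum_Iic_choose_le_pow (k d : ℕ) : ∑ i ∈ Finset.Iic d, k.choose i ≤ (k + 1) ^ d := by
  rw [← Nat.range_succ_eq_Iic]
  induction d with
  | zero => simp
  | succ d ih =>
    rw [Finset.sum_range_succ, pow_succ]
    calc _ ≤ (k + 1) ^ d + k ^ (d + 1) := add_le_add ih (Nat.choose_le_pow _ _)
      _ = (k + 1) ^ d + k ^ d * k := by rw [pow_succ]
      _ ≤ (k + 1) ^ d + (k + 1) ^ d * k := by gcongr; omega
      _ = _ := by ring

open Classical in
/-- The labelings of the points `x i` by members of `F`. -/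
noncomputable def traces {X ι : Type*} [Fintype ι] (F : Set (X → Bool)) (x : ι → X) :
    Finset (ι → Bool) :=
  {c | ∃ f ∈ F, ∀ i, f (x i) = c i}

theorem mem_traces {X ι : Type*} [Fintype ι] {F : Set (X → Bool)} {x : ι → X} {c : ι → Bool} :
    c ∈ traces F x ↔ ∃ f ∈ F, ∀ i, f (x i) = c i := by
  simp [traces]

/-- The **Sauer-Shelah lemma** for classes of `{0,1}`-valued functions. -/
theorem card_traces_le {X ι : Type*} [Fintype ι] {F : Set (X → Bool)} {d : ℕ}
    (hF : ∀ A : Finset X, ShattersSet F A → A.card ≤ d) (x : ι → X) :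
    (traces F x).card ≤ (Fintype.card ι + 1) ^ d := by
  classical
  -- Labelings become sets of indices, so that the Sauer-Shelah lemma for set families applies.
  set 𝒜 : Finset (Finset ι) := (traces F x).image fun c => Finset.univ.filter fun i => c i = true
    with h𝒜
  have hcard : (traces F x).card = 𝒜.card := by
    refine (Finset.card_image_of_injective _ fun c c' h => ?_).symm
    funext i
    have := Finset.ext_iff.1 h i
    rw [Bool.eq_iff_iff]
    simpa using this
  have hvc : 𝒜.vcDim ≤ d := by
    refine Finset.sup_le fun A hA => ?_
    rw [Finset.mem_shatterer] at hA
    have hmem : ∀ t ⊆ A, ∃ f ∈ F, ∀ i ∈ A, (f (x i) = true ↔ i ∈ t) := by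
      intro t ht
      obtain ⟨u, hu, rfl⟩ := hA ht
      obtain ⟨c, hc, rfl⟩ := Finset.mem_image.1 hu
      obtain ⟨f, hf, hfc⟩ := mem_traces.1 hc
      exact ⟨f, hf, fun i hi => by simp [hi, hfc]⟩
    -- The points `x i` may repeat, but not on a shattered index set: some `f` separates `i` from
    -- every other index there. So its image is a shattered set of points of the same size.
    have hinj : Set.InjOn x A := by
      intro i hi j hj hij
      obtain ⟨f, -, hf⟩ := hmem {i} (by simpa using hi)
      have h1 := (hf i hi).2 (by simp)
      rw [hij] at h1
      exact (Finset.mem_singleton.1 ((hf j hj).1 h1)).symm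
    rw [← Finset.card_image_of_injOn hinj]
    refine hF _ fun g => ?_
    obtain ⟨f, hf, h⟩ := hmem (A.filter fun i => g (x i) = true) (Finset.filter_subset _ _)
    refine ⟨f, hf, fun y hy => ?_⟩
    obtain ⟨i, hi, rfl⟩ := Finset.mem_image.1 hy
    have := h i hi
    simpa [hi, ← Bool.eq_iff_iff] using this
  calc (traces F x).card = 𝒜.card := hcard
    _ ≤ 𝒜.shatterer.card := Finset.card_le_card_shatterer _
    _ ≤ ∑ k ∈ Finset.Iic 𝒜.vcDim, (Fintype.card ι).choose k := Finset.card_shatterer_le_sum_vcDim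
    _ ≤ (Fintype.card ι + 1) ^ 𝒜.vcDim := sum_Iic_choose_le_pow _ _
    _ ≤ _ := Nat.pow_le_pow_right (Nat.succ_pos _) hvc

/-! ### Rademacher sums -/

/-- A Rademacher sign. -/
def boolSign (b : Bool) : ℝ := if b then 1 else -1

/-- The sum over sign vectors factors over coordinates, and each factor is `2 * cosh (l * a i)`,
with `cosh u ≤ exp (u ^ 2 / 2)`. -/
theorem sum_exp_boolSign_le {ι : Type*} [Fintype ι] [DecidableEq ι] (a : ι → ℝ) (l : ℝ) :
    ∑ σ : ι → Bool, Real.exp (l * ∑ i, boolSign (σ i) * a i) ≤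
      2 ^ Fintype.card ι * Real.exp (l ^ 2 / 2 * ∑ i, a i ^ 2) := by
  have h1 : ∀ σ : ι → Bool, Real.exp (l * ∑ i, boolSign (σ i) * a i) =
      ∏ i, Real.exp (l * (boolSign (σ i) * a i)) := fun σ => by
    rw [Finset.mul_sum, Real.exp_sum]
  simp_rw [h1]
  rw [← Fintype.prod_sum (fun i (b : Bool) => Real.exp (l * (boolSign b * a i)))]
  rw [Finset.mul_sum, Real.exp_sum, ← Finset.card_univ, ← Finset.prod_const,
    ← Finset.prod_mul_distrib]
  refine Finset.prod_le_prod (fun i _ => by positivity) fun i _ => ?_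
  have := Real.cosh_le_exp_half_sq (l * a i)
  rw [Real.cosh_eq] at this
  simp only [Fintype.sum_bool, boolSign, if_true, Bool.false_eq_true, if_false]
  have e : l ^ 2 / 2 * a i ^ 2 = (l * a i) ^ 2 / 2 := by ring
  rw [e, one_mul, neg_one_mul, mul_neg]
  linarith

/-- Chernoff's bound for both tails, with the probability over signs written as a count. The
parameter `l` stays free because the optimal choice would depend on `a`. -/
theorem card_signs_le {ι : Type*} [Fintype ι] [DecidableEq ι] (a : ι → ℝ) {l : ℝ} (hl : 0 ≤ l) (t : ℝ) :
    ((Finset.univ.filter fun σ : ι → Bool => t < |∑ i, boolSign (σ i) * a i|).card : ℝ) ≤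
      2 ^ Fintype.card ι * (2 * Real.exp (-(l * t) + l ^ 2 / 2 * ∑ i, a i ^ 2)) := by
  have h1 := sum_exp_boolSign_le a l
  have h2 := sum_exp_boolSign_le a (-l)
  rw [neg_sq] at h2
  have key : ((Finset.univ.filter fun σ : ι → Bool =>
      t < |∑ i, boolSign (σ i) * a i|).card : ℝ) * Real.exp (l * t) ≤
      ∑ σ : ι → Bool, (Real.exp (l * ∑ i, boolSign (σ i) * a i) +
        Real.exp (-l * ∑ i, boolSign (σ i) * a i)) := by
    rw [← nsmul_eq_mul, ← Finset.sum_const]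
    refine (Finset.sum_le_sum fun σ hσ => ?_).trans
      (Finset.sum_le_sum_of_subset_of_nonneg (Finset.filter_subset _ _) fun σ _ _ => by positivity)
    have hσ := (Finset.mem_filter.1 hσ).2
    rcases lt_abs.1 hσ with h | h
    · have : Real.exp (l * t) ≤ Real.exp (l * ∑ i, boolSign (σ i) * a i) := by gcongr
      have := Real.exp_pos (-l * ∑ i, boolSign (σ i) * a i)
      linarith
    · have : Real.exp (l * t) ≤ Real.exp (-l * ∑ i, boolSign (σ i) * a i) := by
        rw [neg_mul_comm]; gcongr
      have := Real.exp_pos (l * ∑ i, boolSign (σ i) * a i)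
      linarith
  rw [Finset.sum_add_distrib] at key
  rw [Real.exp_add, Real.exp_neg]
  have hp := Real.exp_pos (l * t)
  rw [← mul_le_mul_iff_left₀ hp]
  refine key.trans ((add_le_add h1 h2).trans (le_of_eq ?_))
  field_simp
  ring

/-! ### Double samples and random swaps -/

section GhostSample

variable {Z X : Type*} {n : ℕ}

/-- The points of a double sample, as one sequence. -/
def doublePoints (x : Z → X) (w : Fin n → Z × Z) : Fin (n + n) → X :=
  Fin.append (fun i => x (w i).1) (fun i => x (w i).2)

/-- The indicator of the event that `f` takes the value `b` on a point of `W`. -/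
noncomputable def hit (x : Z → X) (W : Set Z) (b : Bool) (f : X → Bool) (z : Z) : ℝ :=
  ({z | f (x z) = b} ∩ W).indicator 1 z

/-- The difference of the numbers of hits in the two halves of a double sample. -/
noncomputable def hitDiff (x : Z → X) (W : Set Z) (b : Bool) (w : Fin n → Z × Z) (f : X → Bool) :
    ℝ :=
  ∑ i, (hit x W b f (w i).1 - hit x W b f (w i).2)

/-- Swap the entries of those pairs of a double sample that have the sign `false`. -/
def swapPairs (σ : Fin n → Bool) (w : Fin n → Z × Z) : Fin n → Z × Z :=
  fun i => if σ i then w i else (w i).swap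

open Classical in
/-- The `i`-th term of `hitDiff` for a classifier with labels `c` on the double sample. -/
noncomputable def traceDiff (W : Set Z) (b : Bool) (w : Fin n → Z × Z) (c : Fin (n + n) → Bool)
    (i : Fin n) : ℝ :=
  (if c (Fin.castAdd n i) = b then W.indicator 1 (w i).1 else 0) -
    (if c (Fin.natAdd n i) = b then W.indicator 1 (w i).2 else 0)

/-- The number of points of a double sample that belong to `W`. -/
noncomputable def doubleCount (W : Set Z) (w : Fin n → Z × Z) : ℝ :=
  ∑ i, (W.indicator 1 (w i).1 + W.indicator 1 (w i).2)

/-- The double samples for which some member of `F` has a deviation larger than `t`. -/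
def deviationSet (F : Set (X → Bool)) (x : Z → X) (W : Set Z) (b : Bool) (n : ℕ) (t : ℝ) :
    Set (Fin n → Z × Z) :=
  {w | ∃ f ∈ F, t < |hitDiff x W b w f|}

variable {F : Set (X → Bool)} {x : Z → X} {W : Set Z} {b : Bool}

theorem hit_eq (f : X → Bool) (z : Z) :
    hit x W b f z = if f (x z) = b then W.indicator 1 z else 0 := by
  by_cases h : f (x z) = b <;> by_cases hz : z ∈ W <;> simp [hit, Set.indicator, h, hz]

theorem hit_sub_hit {f : X → Bool} {w : Fin n → Z × Z} {c : Fin (n + n) → Bool}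
    (h : ∀ j, f (doublePoints x w j) = c j) (i : Fin n) :
    hit x W b f (w i).1 - hit x W b f (w i).2 = traceDiff W b w c i := by
  have h1 := h (Fin.castAdd n i)
  have h2 := h (Fin.natAdd n i)
  simp only [doublePoints, Fin.append_left, Fin.append_right] at h1 h2
  rw [hit_eq, hit_eq, traceDiff, h1, h2]

theorem hitDiff_swapPairs (f : X → Bool) (σ : Fin n → Bool) (w : Fin n → Z × Z) :
    hitDiff x W b (swapPairs σ w) f =
      ∑ i, boolSign (σ i) * (hit x W b f (w i).1 - hit x W b f (w i).2) := by
  refine Finset.sum_congr rfl fun i _ => ?_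
  cases h : σ i <;> simp [swapPairs, h, boolSign]

/-- A term is at most 1 in absolute value and vanishes unless one of its two points lies in `W`.
Hence the final rate involves the probability of `W`. -/
theorem sum_traceDiff_sq_le (w : Fin n → Z × Z) (c : Fin (n + n) → Bool) :
    ∑ i, traceDiff W b w c i ^ 2 ≤ doubleCount W w := by
  refine Finset.sum_le_sum fun i _ => ?_
  by_cases h1 : (w i).1 ∈ W <;> by_cases h2 : (w i).2 ∈ W <;>
    by_cases h3 : c (Fin.castAdd n i) = b <;> by_cases h4 : c (Fin.natAdd n i) = b <;>
    simp only [traceDiff, h1, h2, h3, h4, Set.indicator, if_true, if_false, Pi.one_apply] <;>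
    norm_num

/-- The deviation depends on `f` only through its labels on the double sample. The possibly
uncountable union over `F` becomes a finite one, which gives measurability. -/
theorem deviationSet_eq_iUnion (t : ℝ) :
    deviationSet F x W b n t = ⋃ c : Fin (n + n) → Bool,
      {w | ∃ f ∈ F, ∀ j, f (doublePoints x w j) = c j} ∩ {w | t < |∑ i, traceDiff W b w c i|} := by
  ext w
  simp only [deviationSet, Set.mem_ofPred_eq, Set.mem_iUnion, Set.mem_inter_iff]
  constructor
  · rintro ⟨f, hf, h⟩
    refine ⟨fun j => f (doublePoints x w j), ⟨f, hf, fun _ => rfl⟩, ?_⟩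
    rwa [hitDiff, Finset.sum_congr rfl fun i _ => hit_sub_hit (fun _ => rfl) i] at h
  · rintro ⟨c, ⟨f, hf, hc⟩, h⟩
    refine ⟨f, hf, ?_⟩
    rwa [hitDiff, Finset.sum_congr rfl fun i _ => hit_sub_hit hc i]

-- Swapping the entries of pairs puts signs in front of the terms of `hitDiff`. For fixed `w` a
-- union bound over the labelings realized on the `2 * n` points then leaves one Rademacher sum for
-- each.
open Classical in
theorem card_swapPairs_mem_le {d : ℕ} (hF : ∀ A : Finset X, ShattersSet F A → A.card ≤ d)
    (t : ℝ) {l : ℝ} (hl : 0 ≤ l) (w : Fin n → Z × Z) :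
    ((Finset.univ.filter fun σ : Fin n → Bool => swapPairs σ w ∈ deviationSet F x W b n t).card : ℝ)
      ≤ 2 ^ n * ((2 * n + 1) ^ d * (2 * Real.exp (-(l * t) + l ^ 2 / 2 * doubleCount W w))) := by
  have hsub : (Finset.univ.filter fun σ : Fin n → Bool =>
        swapPairs σ w ∈ deviationSet F x W b n t) ⊆
      (traces F (doublePoints x w)).biUnion fun c => Finset.univ.filter fun σ : Fin n → Bool =>
        t < |∑ i, boolSign (σ i) * traceDiff W b w c i| := by
    intro σ hσ
    obtain ⟨f, hf, h⟩ := (Finset.mem_filter.1 hσ).2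
    refine Finset.mem_biUnion.2 ⟨fun j => f (doublePoints x w j),
      mem_traces.2 ⟨f, hf, fun _ => rfl⟩, Finset.mem_filter.2 ⟨Finset.mem_univ _, ?_⟩⟩
    rw [hitDiff_swapPairs] at h
    simpa only [hit_sub_hit (x := x) (f := f) (c := fun j => f (doublePoints x w j))
      (fun _ => rfl)] using h
  have hc : ∀ c ∈ traces F (doublePoints x w),
      ((Finset.univ.filter fun σ : Fin n → Bool =>
        t < |∑ i, boolSign (σ i) * traceDiff W b w c i|).card : ℝ) ≤
      2 ^ n * (2 * Real.exp (-(l * t) + l ^ 2 / 2 * doubleCount W w)) := by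
    intro c _
    refine (card_signs_le (traceDiff W b w c) hl t).trans ?_
    rw [Fintype.card_fin]
    gcongr
    exact sum_traceDiff_sq_le w c
  have htr : ((traces F (doublePoints x w)).card : ℝ) ≤ (2 * n + 1) ^ d := by
    have := card_traces_le hF (doublePoints x w)
    rw [Fintype.card_fin] at this
    rw [two_mul]
    exact_mod_cast this
  calc _ ≤ (((traces F (doublePoints x w)).biUnion fun c => Finset.univ.filter
        fun σ : Fin n → Bool => t < |∑ i, boolSign (σ i) * traceDiff W b w c i|).card : ℝ) := by
        exact_mod_cast Finset.card_le_card hsub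
    _ ≤ ∑ c ∈ traces F (doublePoints x w), ((Finset.univ.filter fun σ : Fin n → Bool =>
        t < |∑ i, boolSign (σ i) * traceDiff W b w c i|).card : ℝ) := by
        exact_mod_cast Finset.card_biUnion_le
    _ ≤ (traces F (doublePoints x w)).card *
        (2 ^ n * (2 * Real.exp (-(l * t) + l ^ 2 / 2 * doubleCount W w))) := by
        rw [← nsmul_eq_mul]; exact Finset.sum_le_card_nsmul _ _ _ hc
    _ ≤ (2 * n + 1) ^ d * (2 ^ n * (2 * Real.exp (-(l * t) + l ^ 2 / 2 * doubleCount W w))) := by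
        gcongr
    _ = _ := by ring

variable [MeasurableSpace Z] [MeasurableSpace X] {μ : Measure Z} [IsProbabilityMeasure μ]

theorem measurable_hit (hx : Measurable x) (hW : MeasurableSet W) {f : X → Bool}
    (hf : Measurable f) : Measurable (hit x W b f) :=
  measurable_one.indicator ((hf.comp hx (measurableSet_singleton b)).inter hW)

theorem measurable_doubleCount (hW : MeasurableSet W) :
    Measurable (doubleCount W : (Fin n → Z × Z) → ℝ) := by
  have h := measurable_one.indicator hW (f := (1 : Z → ℝ))
  exact Finset.measurable_sum _ fun i _ =>
    (h.comp (measurable_fst.comp (measurable_pi_apply i))).add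
      (h.comp (measurable_snd.comp (measurable_pi_apply i)))

theorem measurable_traceDiff (hW : MeasurableSet W) (c : Fin (n + n) → Bool) (i : Fin n) :
    Measurable fun w : Fin n → Z × Z => traceDiff W b w c i := by
  have h := measurable_one.indicator hW (f := (1 : Z → ℝ))
  exact (Measurable.ite (MeasurableSet.const _)
      (h.comp (measurable_fst.comp (measurable_pi_apply i))) measurable_const).sub
    (Measurable.ite (MeasurableSet.const _)
      (h.comp (measurable_snd.comp (measurable_pi_apply i))) measurable_const)

/-- `MeasurableClass` speaks of i.i.d. samples; this carries it to double samples, read as samples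
of size `n + n`. -/
theorem measurePreserving_doublePoints (hx : Measurable x) :
    MeasurePreserving (doublePoints x : (Fin n → Z × Z) → _)
      (Measure.pi fun _ => μ.prod μ) (Measure.pi fun _ => μ.map x) := by
  have : IsProbabilityMeasure (μ.map x) := Measure.isProbabilityMeasure_map hx.aemeasurable
  have hm : Measurable (doublePoints x : (Fin n → Z × Z) → _) := by
    refine measurable_pi_iff.2 fun j => ?_
    refine Fin.addCases (fun i => ?_) (fun i => ?_) j
    · simp only [doublePoints, Fin.append_left]
      exact hx.comp (measurable_fst.comp (measurable_pi_apply i))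
    · simp only [doublePoints, Fin.append_right]
      exact hx.comp (measurable_snd.comp (measurable_pi_apply i))
  refine ⟨hm, (Measure.pi_eq fun s hs => ?_).symm⟩
  rw [Measure.map_apply hm (MeasurableSet.univ_pi hs)]
  have : doublePoints x ⁻¹' (Set.univ.pi s) = Set.univ.pi fun i : Fin n =>
      (x ⁻¹' s (Fin.castAdd n i)) ×ˢ (x ⁻¹' s (Fin.natAdd n i)) := by
    ext w
    simp only [Set.mem_preimage, Set.mem_univ_pi, Fin.forall_fin_add, doublePoints,
      Fin.append_left, Fin.append_right, Set.mem_prod, forall_and]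
  rw [this, Measure.pi_pi, Fin.prod_univ_add, ← Finset.prod_mul_distrib]
  refine Finset.prod_congr rfl fun i _ => ?_
  rw [Measure.prod_prod, Measure.map_apply hx (hs _), Measure.map_apply hx (hs _)]

theorem nullMeasurableSet_deviationSet (hx : Measurable x) (hW : MeasurableSet W)
    (hF : MeasurableClass (μ.map x) F) (t : ℝ) :
    NullMeasurableSet (deviationSet F x W b n t) (Measure.pi fun _ => μ.prod μ) := by
  rw [deviationSet_eq_iUnion]
  refine NullMeasurableSet.iUnion fun c => NullMeasurableSet.inter ?_ ?_
  · exact (hF.2 (n + n) c).preimage (measurePreserving_doublePoints hx).quasiMeasurePreserving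
  · exact (measurableSet_lt measurable_const
      (Finset.measurable_sum _ fun i _ => measurable_traceDiff hW c i).norm).nullMeasurableSet

theorem measurePreserving_swapPairs (σ : Fin n → Bool) :
    MeasurePreserving (swapPairs σ : (Fin n → Z × Z) → _)
      (Measure.pi fun _ => μ.prod μ) (Measure.pi fun _ => μ.prod μ) := by
  refine measurePreserving_pi (fun _ : Fin n => μ.prod μ) (fun _ => μ.prod μ)
    (f := fun i p => if σ i then p else p.swap) fun i => ?_
  cases σ i
  · simpa using Measure.measurePreserving_swap
  · exact MeasurePreserving.id (μ.prod μ)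

/-- Swaps preserve the law of the double sample, so the probability equals its average over all `2 ^
n` swaps. Exchanging sum and integral leaves a count of swaps for each fixed `w`, to which
`card_swapPairs_mem_le` applies. -/
theorem measure_deviationSet_le_lintegral {d : ℕ}
    (hd : ∀ A : Finset X, ShattersSet F A → A.card ≤ d) (hx : Measurable x)
    (hW : MeasurableSet W) (hF : MeasurableClass (μ.map x) F) (t : ℝ) {l : ℝ} (hl : 0 ≤ l) :
    (Measure.pi fun _ => μ.prod μ) (deviationSet F x W b n t) ≤
      ∫⁻ w, ENNReal.ofReal ((2 * n + 1) ^ d *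
        (2 * Real.exp (-(l * t) + l ^ 2 / 2 * doubleCount W w)))
          ∂(Measure.pi fun _ : Fin n => μ.prod μ) := by
  classical
  set ν := Measure.pi fun _ : Fin n => μ.prod μ
  set B := deviationSet F x W b n t
  have hB : NullMeasurableSet B ν := nullMeasurableSet_deviationSet hx hW hF t
  have hσ : ∀ σ : Fin n → Bool, NullMeasurableSet (swapPairs σ ⁻¹' B) ν := fun σ =>
    hB.preimage (measurePreserving_swapPairs σ).quasiMeasurePreserving
  have h2 : ((2 : ENNReal) ^ n) * ν B ≤ 2 ^ n * ∫⁻ w, ENNReal.ofReal ((2 * n + 1) ^ d *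
        (2 * Real.exp (-(l * t) + l ^ 2 / 2 * doubleCount W w))) ∂ν := by
    calc ((2 : ENNReal) ^ n) * ν B = ∑ σ : Fin n → Bool, ν (swapPairs σ ⁻¹' B) := by
          rw [Finset.sum_congr rfl fun σ _ =>
            (measurePreserving_swapPairs σ).measure_preimage hB]
          simp [ν]
      _ = ∑ σ : Fin n → Bool, ∫⁻ w, (swapPairs σ ⁻¹' B).indicator (1 : (Fin n → Z × Z) → ENNReal) w ∂ν := by
          exact Finset.sum_congr rfl fun σ _ => (lintegral_indicator_one₀ (hσ σ)).symm
      _ = ∫⁻ w, ∑ σ : Fin n → Bool, (swapPairs σ ⁻¹' B).indicator (1 : (Fin n → Z × Z) → ENNReal) w ∂ν :=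
          (lintegral_finsetSum' _ fun σ _ => aemeasurable_one.indicator₀ (hσ σ)).symm
      _ ≤ ∫⁻ w, 2 ^ n * ENNReal.ofReal ((2 * n + 1) ^ d *
            (2 * Real.exp (-(l * t) + l ^ 2 / 2 * doubleCount W w))) ∂ν := by
          refine lintegral_mono fun w => ?_
          have h := card_swapPairs_mem_le (x := x) (W := W) (b := b) hd t hl w
          have e : ∑ σ : Fin n → Bool, (swapPairs σ ⁻¹' B).indicator (1 : (Fin n → Z × Z) → ENNReal) w =
              ((Finset.univ.filter fun σ : Fin n → Bool => swapPairs σ w ∈ B).card : ENNReal) := by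
            simp [Set.indicator, Finset.sum_boole]
          rw [e]
          have := ENNReal.ofReal_le_ofReal h
          rw [ENNReal.ofReal_natCast, ENNReal.ofReal_mul (by positivity),
            ENNReal.ofReal_pow (by norm_num)] at this
          simpa using this
      _ = _ := lintegral_const_mul' _ _ (by simp)
  exact (ENNReal.mul_le_mul_iff_right (by simp) (by simp)).1 h2

end GhostSample

/-! ### Uniform deviation of counts at the scale of a rare event -/

section Deviation

variable {Z X : Type*} {n : ℕ} {F : Set (X → Bool)} {x : Z → X} {W : Set Z} {b : Bool}

theorem doubleCount_le (w : Fin n → Z × Z) : doubleCount W w ≤ n * 2 := by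
  have h (z : Z) : W.indicator (1 : Z → ℝ) z ≤ 1 := Set.indicator_le_self' (by simp) z
  calc doubleCount W w ≤ ∑ _i : Fin n, (2 : ℝ) :=
        Finset.sum_le_sum fun i _ => by linarith [h (w i).1, h (w i).2]
    _ = n * 2 := by simp

theorem hit_nonneg (f : X → Bool) (z : Z) : 0 ≤ hit x W b f z :=
  Set.indicator_nonneg (fun _ _ => zero_le_one) _

theorem hit_le_one (f : X → Bool) (z : Z) : hit x W b f z ≤ 1 :=
  Set.indicator_le_self' (by simp) z

variable [MeasurableSpace Z] [MeasurableSpace X] {μ : Measure Z} [IsProbabilityMeasure μ]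

/-- On `[0, 1]` one has `exp c - 1 ≤ 2 * c`; then `1 + u ≤ exp u`. -/
theorem integral_exp_indicator_le (hW : MeasurableSet W) {c : ℝ} (hc : 0 ≤ c) (hc1 : c ≤ 1) :
    ∫ z, Real.exp (c * W.indicator 1 z) ∂μ ≤ Real.exp (2 * c * μ.real W) := by
  have e : ∀ z, Real.exp (c * W.indicator 1 z) = 1 + (Real.exp c - 1) * W.indicator 1 z := by
    intro z
    by_cases h : z ∈ W <;> simp [h]
  have hi : Integrable (W.indicator (1 : Z → ℝ)) μ := (integrable_const 1).indicator hW
  simp_rw [e]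
  rw [integral_add (integrable_const _) (hi.const_mul _), integral_const_mul,
    integral_indicator_one hW]
  have h1 : Real.exp c - 1 ≤ 2 * c := by
    have := Real.abs_exp_sub_one_le (x := c) (by rwa [abs_of_nonneg hc])
    rw [abs_of_nonneg hc] at this
    exact (le_abs_self _).trans this
  have h2 : (Real.exp c - 1) * μ.real W ≤ 2 * c * μ.real W := by gcongr
  have h3 := Real.add_one_le_exp (2 * c * μ.real W)
  simp only [integral_const, probReal_univ, smul_eq_mul, mul_one]
  linarith

theorem integral_exp_doubleCount_le (hW : MeasurableSet W) {c : ℝ} (hc : 0 ≤ c) (hc1 : c ≤ 1) :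
    ∫ w, Real.exp (c * doubleCount W w) ∂(Measure.pi fun _ : Fin n => μ.prod μ) ≤
      Real.exp (4 * n * c * μ.real W) := by
  have e : ∀ w : Fin n → Z × Z, Real.exp (c * doubleCount W w) =
      ∏ i, (fun p : Z × Z => Real.exp (c * W.indicator 1 p.1) * Real.exp (c * W.indicator 1 p.2))
        (w i) := by
    intro w
    rw [doubleCount, Finset.mul_sum, Real.exp_sum]
    exact Finset.prod_congr rfl fun i _ => by rw [mul_add, Real.exp_add]
  simp_rw [e]
  rw [integral_fintype_prod_eq_pow (μ := μ.prod μ)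
    (fun p : Z × Z => Real.exp (c * W.indicator 1 p.1) * Real.exp (c * W.indicator 1 p.2)),
    integral_prod_mul (fun z => Real.exp (c * W.indicator 1 z))
      (fun z => Real.exp (c * W.indicator 1 z)), Fintype.card_fin]
  have h0 : 0 ≤ ∫ z, Real.exp (c * W.indicator 1 z) ∂μ :=
    integral_nonneg fun z => (Real.exp_pos _).le
  have h1 := integral_exp_indicator_le (μ := μ) hW hc hc1
  calc _ ≤ (Real.exp (2 * c * μ.real W) * Real.exp (2 * c * μ.real W)) ^ n := by gcongr
    _ = _ := by rw [← Real.exp_add, ← Real.exp_nat_mul]; congr 1; ring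

/-- Integrates the random variance proxy `doubleCount` with exponent `c = l ^ 2 / 2`; the
restriction `l ≤ 1` keeps `c` in `[0, 1]`. -/
theorem measure_deviationSet_le {d : ℕ} (hd : ∀ A : Finset X, ShattersSet F A → A.card ≤ d)
    (hx : Measurable x) (hW : MeasurableSet W) (hF : MeasurableClass (μ.map x) F) (t : ℝ) {l : ℝ}
    (hl : 0 ≤ l) (hl1 : l ≤ 1) :
    (Measure.pi fun _ => μ.prod μ) (deviationSet F x W b n t) ≤
      ENNReal.ofReal ((2 * n + 1) ^ d * (2 * Real.exp (-(l * t) + 2 * n * l ^ 2 * μ.real W))) := by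
  refine (measure_deviationSet_le_lintegral hd hx hW hF t hl).trans ?_
  set ν := Measure.pi fun _ : Fin n => μ.prod μ
  have e : ∀ w : Fin n → Z × Z, (2 * (n : ℝ) + 1) ^ d *
        (2 * Real.exp (-(l * t) + l ^ 2 / 2 * doubleCount W w)) =
      (2 * (n : ℝ) + 1) ^ d * (2 * Real.exp (-(l * t))) *
        Real.exp (l ^ 2 / 2 * doubleCount W w) := fun w => by rw [Real.exp_add]; ring
  have hint : Integrable (fun w => Real.exp (l ^ 2 / 2 * doubleCount W w)) ν := by
    refine Integrable.of_bound
      ((measurable_doubleCount hW).const_mul _).exp.aestronglyMeasurable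
      (Real.exp (l ^ 2 / 2 * (n * 2))) (Filter.Eventually.of_forall fun w => ?_)
    rw [Real.norm_of_nonneg (Real.exp_pos _).le]
    gcongr
    exact doubleCount_le w
  simp_rw [e]
  rw [← ofReal_integral_eq_lintegral_ofReal (hint.const_mul _)
    (Filter.Eventually.of_forall fun w => by positivity), integral_const_mul]
  refine ENNReal.ofReal_le_ofReal ?_
  have hl2 : l ^ 2 ≤ 1 := pow_le_one₀ hl hl1
  have := integral_exp_doubleCount_le (n := n) (μ := μ) hW (c := l ^ 2 / 2) (by positivity)
    (by linarith)
  calc _ ≤ (2 * (n : ℝ) + 1) ^ d * (2 * Real.exp (-(l * t))) *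
        Real.exp (4 * n * (l ^ 2 / 2) * μ.real W) := by gcongr
    _ = _ := by
      rw [Real.exp_add, show 4 * (n : ℝ) * (l ^ 2 / 2) * μ.real W = 2 * n * l ^ 2 * μ.real W by ring]
      ring

theorem memLp_hit (hx : Measurable x) (hW : MeasurableSet W) {f : X → Bool} (hf : Measurable f) :
    MemLp (hit x W b f) 2 μ :=
  MemLp.of_bound (measurable_hit hx hW hf).aestronglyMeasurable 1
    (Filter.Eventually.of_forall fun z => by
      rw [Real.norm_of_nonneg (hit_nonneg f z)]; exact hit_le_one f z)

omit [IsProbabilityMeasure μ] in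
theorem integral_hit (hx : Measurable x) (hW : MeasurableSet W) {f : X → Bool}
    (hf : Measurable f) : ∫ z, hit x W b f z ∂μ = μ.real ({z | f (x z) = b} ∩ W) :=
  integral_indicator_one ((hf.comp hx (measurableSet_singleton b)).inter hW)

theorem variance_hit_le (hx : Measurable x) (hW : MeasurableSet W) {f : X → Bool}
    (hf : Measurable f) : Var[hit x W b f; μ] ≤ μ.real W := by
  refine (variance_le_expectation_sq (measurable_hit hx hW hf).aestronglyMeasurable).trans ?_
  have e : hit x W b f ^ 2 = hit x W b f := by
    funext z
    by_cases h : z ∈ {z | f (x z) = b} ∩ W <;> simp [hit, h]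
  rw [e, integral_hit hx hW hf]
  exact measureReal_mono Set.inter_subset_right

/-- Chebyshev's inequality for the number of hits of one classifier. -/
theorem measure_hit_deviation_le (hx : Measurable x) (hW : MeasurableSet W) {f : X → Bool}
    (hf : Measurable f) {t : ℝ} (ht : 0 < t) :
    (Measure.pi fun _ : Fin n => μ)
      {s | t ≤ |∑ i, hit x W b f (s i) - n * ∫ z, hit x W b f z ∂μ|} ≤
      ENNReal.ofReal (n * μ.real W / t ^ 2) := by
  set ρ := Measure.pi fun _ : Fin n => μ
  have hL : ∀ i : Fin n, MemLp (fun s : Fin n → Z => hit x W b f (s i)) 2 ρ := fun i =>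
    (memLp_hit hx hW hf).comp_measurePreserving (measurePreserving_eval (fun _ => μ) i)
  have hsum : MemLp (∑ i, fun s : Fin n → Z => hit x W b f (s i)) 2 ρ :=
    memLp_finsetSum' _ fun i _ => hL i
  have hexp : ρ[∑ i, fun s : Fin n → Z => hit x W b f (s i)] = n * ∫ z, hit x W b f z ∂μ := by
    simp_rw [Finset.sum_apply]
    rw [integral_finsetSum _ fun i _ => (hL i).integrable (by norm_num)]
    have : ∀ i : Fin n, ∫ s, hit x W b f (s i) ∂ρ = ∫ z, hit x W b f z ∂μ := fun i =>
      integral_comp_eval (μ := fun _ : Fin n => μ) (measurable_hit hx hW hf).aestronglyMeasurable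
    simp [this]
  have hcheb := meas_ge_le_variance_div_sq hsum ht
  rw [hexp] at hcheb
  simp_rw [Finset.sum_apply] at hcheb
  refine hcheb.trans (ENNReal.ofReal_le_ofReal ?_)
  gcongr
  rw [variance_sum_pi (X := fun _ => hit x W b f) fun _ => memLp_hit hx hW hf]
  calc _ ≤ ∑ _i : Fin n, μ.real W := Finset.sum_le_sum fun _ _ => variance_hit_le hx hW hf
    _ = n * μ.real W := by simp

/-- Symmetrization by a ghost sample. -/
theorem measure_deviation_le_two_mul (hx : Measurable x) (hW : MeasurableSet W)
    (hF : ∀ f ∈ F, Measurable f) {t : ℝ} (ht : 0 < t) (h8 : 8 * (n * μ.real W) ≤ t ^ 2) :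
    (Measure.pi fun _ : Fin n => μ)
      {s | ∃ f ∈ F, t < |∑ i, hit x W b f (s i) - n * ∫ z, hit x W b f z ∂μ|} ≤
      2 * (Measure.pi fun _ => μ.prod μ) (deviationSet F x W b n (t / 2)) := by
  set ρ := Measure.pi fun _ : Fin n => μ
  set ν := Measure.pi fun _ : Fin n => μ.prod μ
  set B := deviationSet F x W b n (t / 2)
  set e := MeasurableEquiv.arrowProdEquivProdArrow Z Z (Fin n)
  have he : MeasurePreserving e.symm (ρ.prod ρ) ν :=
    (measurePreserving_arrowProdEquivProdArrow Z Z (Fin n) (fun _ => μ) fun _ => μ).symm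
  -- A measurable hull of the same measure makes Fubini and Markov available. The event for a single
  -- sample is only bounded in outer measure.
  set T := e.symm ⁻¹' toMeasurable ν B
  have hT : MeasurableSet T := e.symm.measurable (measurableSet_toMeasurable _ _)
  have hTB : (ρ.prod ρ) T = ν B := by
    rw [he.measure_preimage (measurableSet_toMeasurable _ _).nullMeasurableSet,
      measure_toMeasurable]
  have hsub : {s | ∃ f ∈ F, t < |∑ i, hit x W b f (s i) - n * ∫ z, hit x W b f z ∂μ|} ⊆
      {s | (1 / 2 : ENNReal) ≤ ρ (Prod.mk s ⁻¹' T)} := by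
    rintro s ⟨f, hf, hs⟩
    set G := {s' : Fin n → Z | t / 2 ≤ |∑ i, hit x W b f (s' i) - n * ∫ z, hit x W b f z ∂μ|}
    -- Chebyshev at `t / 2` gives `4 * n * μ.real W / t ^ 2`, at most `1 / 2` by `h8`.
    have hG : ρ G ≤ 1 / 2 := by
      refine (measure_hit_deviation_le hx hW (hF f hf) (half_pos ht)).trans ?_
      rw [show (1 / 2 : ENNReal) = ENNReal.ofReal (1 / 2) by
        rw [ENNReal.ofReal_div_of_pos (by norm_num)]; simp]
      refine ENNReal.ofReal_le_ofReal ?_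
      rw [div_le_div_iff₀ (by positivity) (by norm_num)]
      nlinarith
    -- If the first half deviates by more than `t` and the ghost half by less than `t / 2`, the two
    -- counts differ by more than `t / 2`.
    have hGT : Gᶜ ⊆ Prod.mk s ⁻¹' T := by
      intro s' hs'
      have hs' : |∑ i, hit x W b f (s' i) - n * ∫ z, hit x W b f z ∂μ| < t / 2 := not_le.1 hs'
      refine subset_toMeasurable ν B ⟨f, hf, ?_⟩
      have h3 : hitDiff x W b (e.symm (s, s')) f =
          ∑ i, hit x W b f (s i) - ∑ i, hit x W b f (s' i) := by
        rw [← Finset.sum_sub_distrib]; rfl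
      rw [h3]
      have := abs_sub_abs_le_abs_sub (∑ i, hit x W b f (s i) - n * ∫ z, hit x W b f z ∂μ)
        (∑ i, hit x W b f (s' i) - n * ∫ z, hit x W b f z ∂μ)
      rw [sub_sub_sub_cancel_right] at this
      linarith
    have h1 : 1 ≤ ρ G + ρ Gᶜ := by
      rw [← measure_univ (μ := ρ), ← Set.union_compl_self G]
      exact measure_union_le _ _
    have h2 : (1 / 2 : ENNReal) ≤ ρ Gᶜ := by
      by_contra h
      have h := not_le.1 h
      have : ρ G + ρ Gᶜ < 1 / 2 + 1 / 2 := ENNReal.add_lt_add_of_le_of_lt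
        (measure_ne_top _ _) hG h
      rw [ENNReal.add_halves] at this
      exact absurd h1 (not_le.2 this)
    exact h2.trans (measure_mono hGT)
  -- Markov's inequality for the section measure, whose integral is the measure of `T` by Fubini.
  have hmark := mul_meas_ge_le_lintegral (μ := ρ) (measurable_measure_prodMk_left (ν := ρ) hT) (1 / 2)
  rw [← Measure.prod_apply hT, hTB] at hmark
  refine (measure_mono hsub).trans ?_
  calc _ = 2 * (1 / 2 * ρ {s | (1 / 2 : ENNReal) ≤ ρ (Prod.mk s ⁻¹' T)}) := by
        rw [← mul_assoc, one_div, ENNReal.mul_inv_cancel (by simp) (by simp), one_mul]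
    _ ≤ _ := by gcongr

/-- Uniform convergence of the number of hits over a class of finite VC dimension, at the rate
given by the probability of `W`. -/
theorem measure_uniform_deviation_le {d : ℕ}
    (hd : ∀ A : Finset X, ShattersSet F A → A.card ≤ d) (hx : Measurable x)
    (hW : MeasurableSet W) (hF : MeasurableClass (μ.map x) F) {t : ℝ} (hp : 0 < n * μ.real W)
    (ht : 0 < t) (h8 : 8 * (n * μ.real W) ≤ t ^ 2) (ht8 : t ≤ 8 * (n * μ.real W)) :
    (Measure.pi fun _ : Fin n => μ)
      {s | ∃ f ∈ F, t < |∑ i, hit x W b f (s i) - n * ∫ z, hit x W b f z ∂μ|} ≤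
      ENNReal.ofReal (4 * (2 * n + 1) ^ d * Real.exp (-(t ^ 2 / (32 * (n * μ.real W))))) := by
  refine (measure_deviation_le_two_mul hx hW hF.1 ht h8).trans ?_
  set q := n * μ.real W with hq
  -- The value `l = t / (8 * q)` minimizes `-(l * t / 2) + 2 * q * l ^ 2`, with minimum `-(t ^ 2 /
  -- (32 * q))`; `ht8` says that `l ≤ 1`.
  have h := measure_deviationSet_le (b := b) (n := n) hd hx hW hF (t / 2) (l := t / (8 * q))
    (by positivity) (by rw [div_le_one (by positivity)]; exact ht8)
  calc _ ≤ 2 * ENNReal.ofReal _ := by gcongr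
    _ = _ := by
      rw [show (2 : ENNReal) = ENNReal.ofReal 2 by simp, ← ENNReal.ofReal_mul (by norm_num)]
      have : -(t / (8 * q) * (t / 2)) + 2 * n * (t / (8 * q)) ^ 2 * μ.real W =
          -(t ^ 2 / (32 * q)) := by
        rw [show 2 * n * (t / (8 * q)) ^ 2 * μ.real W = 2 * (t / (8 * q)) ^ 2 * q by
          rw [hq]; ring]
        field_simp
        ring
      rw [this]
      ring_nf

end Deviation

/-! ### The rate -/

theorem card_le_vcDimension {X : Type*} {F : Set (X → Bool)} (h : vcDimension F ≠ ⊤)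
    (A : Finset X) (hA : ShattersSet F A) : A.card ≤ (vcDimension F).toNat := by
  have : (A.card : ℕ∞) ≤ vcDimension F :=
    le_iSup₂ (f := fun (A : Finset X) (_ : ShattersSet F A) => (A.card : ℕ∞)) A hA
  rw [← ENat.natCast_toNat h] at this
  exact_mod_cast this

/-- Two distinct members would shatter a point where they differ. Dimension 0 needs this separate
treatment because `complexity` is then only `log (1 / δ)`, too small to absorb constant factors. -/
theorem subsingleton_of_vcDimension_eq_zero {X : Type*} {F : Set (X → Bool)}
    (hd : ∀ A : Finset X, ShattersSet F A → A.card ≤ 0) : F.Subsingleton := by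
  intro f hf g hg
  by_contra hne
  obtain ⟨a, ha⟩ := Function.ne_iff.1 hne
  have := hd {a} fun c => by
    by_cases hc : f a = c a
    · exact ⟨f, hf, by simpa using hc⟩
    · exact ⟨g, hg, by
        simpa using (by decide : ∀ p q r : Bool, p ≠ q → p ≠ r → q = r) _ _ _ ha hc⟩
  simp at this

/-- Together with `measurableClass_const`, this lets the label counts be handled by the same uniform
bound, applied to a class with one constant member. -/
theorem card_le_of_shattersSet_singleton {X : Type*} (f : X → Bool) (A : Finset X)
    (hA : ShattersSet {f} A) : A.card ≤ 0 := by
  rw [Nat.le_zero, Finset.card_eq_zero, Finset.eq_empty_iff_forall_notMem]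
  intro a ha
  obtain ⟨g, rfl, h⟩ := hA fun a => !(f a)
  simpa using h a ha

theorem measurableClass_const {X : Type*} [MeasurableSpace X] (Q : Measure X) (b : Bool) :
    MeasurableClass Q {fun _ : X => b} := by
  refine ⟨fun f hf => ?_, fun k c => ?_⟩
  · rw [Set.mem_singleton_iff.1 hf]; exact measurable_const
  · have : {x : Fin k → X | ∃ f ∈ ({fun _ : X => b} : Set (X → Bool)), ∀ i, f (x i) = c i} =
        {_x | ∀ i, b = c i} := by ext; simp
    rw [this]
    exact (MeasurableSet.const _).nullMeasurableSet

/-- The numerator of the excess risk rate. -/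
noncomputable def complexity (d n : ℕ) (δ : ℝ) : ℝ := d * Real.log (n + 1) + Real.log (1 / δ)

/-- The prefactor is absorbed through `2 * n + 1 ≤ (n + 1) ^ 2` and `16 ≤ (n + 1) ^ (4 * d)`, which
cost `6 * d * log (n + 1)` of the exponent. The quarter of `δ` leaves room for four events. -/
theorem complexity_bounds {d n : ℕ} (hd : 1 ≤ d) (hn : 0 < n) {δ : ℝ} (hδ : 0 < δ) (hδ1 : δ < 1) :
    1 / 2 ≤ complexity d n δ ∧
      4 * (2 * n + 1) ^ d * Real.exp (-(8 * complexity d n δ)) ≤ δ / 4 := by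
  have hn1 : (1 : ℝ) ≤ n := by exact_mod_cast hn
  have hd1 : (1 : ℝ) ≤ d := by exact_mod_cast hd
  have hlogδ : 0 < Real.log (1 / δ) := Real.log_pos (by rw [lt_div_iff₀ hδ]; linarith)
  have hlog : 1 / 2 ≤ Real.log (n + 1) := by
    have := Real.log_two_gt_d9
    have : Real.log 2 ≤ Real.log (n + 1) := Real.log_le_log (by norm_num) (by linarith)
    linarith
  have hdlog : Real.log (n + 1) ≤ d * Real.log (n + 1) := le_mul_of_one_le_left (by linarith) hd1
  refine ⟨by unfold complexity; linarith, ?_⟩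
  have h1 : 4 * (2 * (n : ℝ) + 1) ^ d * 4 ≤ ((n : ℝ) + 1) ^ (6 * d) := by
    have h2 : (2 * (n : ℝ) + 1) ^ d ≤ ((n : ℝ) + 1) ^ (2 * d) := by
      rw [pow_mul]; gcongr; nlinarith
    have h4 : (16 : ℝ) ≤ ((n : ℝ) + 1) ^ (4 * d) := by
      calc (16 : ℝ) = 2 ^ 4 := by norm_num
        _ ≤ ((n : ℝ) + 1) ^ 4 := by gcongr; linarith
        _ ≤ ((n : ℝ) + 1) ^ (4 * d) := pow_le_pow_right₀ (by linarith) (by omega)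
    calc _ = 16 * (2 * (n : ℝ) + 1) ^ d := by ring
      _ ≤ ((n : ℝ) + 1) ^ (4 * d) * ((n : ℝ) + 1) ^ (2 * d) := by gcongr
      _ = _ := by rw [← pow_add]; congr 1; ring
  have h6 : ((n : ℝ) + 1) ^ (6 * d) = Real.exp (6 * (d * Real.log (n + 1))) := by
    rw [← Real.exp_log (show (0 : ℝ) < n + 1 by positivity), ← Real.exp_nat_mul, Real.log_exp]
    push_cast
    ring_nf
  have h7 : δ = Real.exp (-Real.log (1 / δ)) := by
    rw [one_div, Real.log_inv, neg_neg, Real.exp_log hδ]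
  rw [h6] at h1
  have h8 : Real.exp (6 * (d * Real.log (n + 1))) * Real.exp (-(8 * complexity d n δ)) ≤ δ := by
    conv_rhs => rw [h7]
    rw [← Real.exp_add]
    refine Real.exp_le_exp.2 ?_
    unfold complexity
    linarith
  have h9 := mul_le_mul_of_nonneg_right h1 (Real.exp_pos (-(8 * complexity d n δ))).le
  linarith

section Rate

variable {Z X : Type*} [MeasurableSpace Z] [MeasurableSpace X] {n : ℕ} {F : Set (X → Bool)}
  {x : Z → X} {W : Set Z} {b : Bool} {μ : Measure Z} [IsProbabilityMeasure μ]

/-- The choice `t = 16 * √(q * L)` makes `t ^ 2 / (32 * q) = 8 * L`. The assumption `1024 * L ≤ q`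
gives `t ≤ q / 2`, and `L ≥ 1 / 2` gives `8 * q ≤ t ^ 2`. -/
theorem measure_uniform_deviation_le_quarter {d : ℕ} (hd1 : 1 ≤ d) (hn : 0 < n)
    (hd : ∀ A : Finset X, ShattersSet F A → A.card ≤ d) (hx : Measurable x)
    (hW : MeasurableSet W) (hF : MeasurableClass (μ.map x) F) {δ : ℝ} (hδ : 0 < δ) (hδ1 : δ < 1)
    (hL : 1024 * complexity d n δ ≤ n * μ.real W) :
    (Measure.pi fun _ : Fin n => μ)
      {s | ∃ f ∈ F, 16 * √(n * μ.real W * complexity d n δ) <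
        |∑ i, hit x W b f (s i) - n * ∫ z, hit x W b f z ∂μ|} ≤ ENNReal.ofReal (δ / 4) := by
  obtain ⟨h1, h2⟩ := complexity_bounds hd1 hn hδ hδ1
  set L := complexity d n δ
  set q := n * μ.real W with hq
  have hq0 : 0 < q := by linarith
  have hsq : √(q * L) ^ 2 = q * L := Real.sq_sqrt (by positivity)
  have hle : √(q * L) ≤ q / 32 := by
    rw [← Real.sqrt_sq (show 0 ≤ q / 32 by positivity)]
    refine Real.sqrt_le_sqrt ?_
    nlinarith
  refine (measure_uniform_deviation_le hd hx hW hF hq0 (by positivity) ?_ ?_).trans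
    (ENNReal.ofReal_le_ofReal ?_)
  · rw [mul_pow, hsq]; nlinarith
  · linarith
  · rw [mul_pow, hsq, show 16 ^ 2 * (q * L) / (32 * q) = 8 * L by field_simp; ring]
    exact h2

end Rate

/-- The difference is `(G - q * r - (N - q) * r) / N`: its numerator is at most `2 * t` in absolute
value, its denominator at least `q / 2`. -/
theorem abs_div_sub_le {G N q r t : ℝ} (hr0 : 0 ≤ r) (hr1 : r ≤ 1) (hq : 0 < q)
    (hG : |G - q * r| ≤ t) (hN : |N - q| ≤ t) (ht : t ≤ q / 2) : |G / N - r| ≤ 4 * t / q := by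
  have hN2 : q / 2 ≤ N := by linarith [(abs_le.1 hN).1]
  have hN0 : 0 < N := by linarith
  have h0 : 0 ≤ t := (abs_nonneg _).trans hG
  have e : G / N - r = (G - q * r - (N - q) * r) / N := by field_simp; ring
  have h1 : |(N - q) * r| ≤ t := by
    rw [abs_mul, abs_of_nonneg hr0]
    exact (mul_le_of_le_one_right (abs_nonneg _) hr1).trans hN
  have h2 : |G - q * r - (N - q) * r| ≤ 2 * t := (abs_sub _ _).trans (by linarith)
  rw [e, abs_div, abs_of_pos hN0, div_le_div_iff₀ hN0 hq]
  nlinarith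

/-! ### Balanced errors under conditionally independent label noise -/

section Noise

variable {X₀ X₁ : Type*} [MeasurableSpace X₀] [MeasurableSpace X₁]
  {P : Measure ((X₀ × X₁) × Bool)} [IsProbabilityMeasure P] {Yt : X₀ → Pseudolabel}

/-- The balanced error of `f` on the pseudolabels `Yt`. -/
noncomputable def pseudoBalancedError (P : Measure ((X₀ × X₁) × Bool)) (Yt : X₀ → Pseudolabel)
    (f : X₁ → Bool) : ℝ :=
  (P.real ({z | f z.1.2 = false} ∩ {z | Yt z.1.1 = some true}) /
      P.real {z | Yt z.1.1 = some true} +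
    P.real ({z | f z.1.2 = true} ∩ {z | Yt z.1.1 = some false}) /
      P.real {z | Yt z.1.1 = some false}) / 2

theorem measurableSet_pseudolabel (hYt : Measurable Yt) (o : Pseudolabel) :
    MeasurableSet {x | Yt x = o} :=
  hYt (t := {o}) trivial

theorem measurableSet_fst_pseudolabel (hYt : Measurable Yt) (o : Pseudolabel) :
    MeasurableSet {z : (X₀ × X₁) × Bool | Yt z.1.1 = o} :=
  (measurable_fst.comp measurable_fst) (measurableSet_pseudolabel hYt o)

theorem measurableSet_label (y : Bool) : MeasurableSet {z : (X₀ × X₁) × Bool | z.2 = y} :=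
  measurable_snd (measurableSet_singleton y)

theorem measureReal_inter_label (S : Set ((X₀ × X₁) × Bool)) :
    P.real ({z | z.2 = true} ∩ S) + P.real ({z | z.2 = false} ∩ S) = P.real S := by
  rw [← measureReal_inter_add_sdiff (s := S) (measurableSet_label true), Set.inter_comm]
  congr 2
  ext z
  simp [and_comm]

/-- Multiplying conditional independence by the mass of the label removes the conditioning from all
factors but one, and the identity survives when the label has probability zero. -/
theorem measureReal_inter_of_condIndepViews (h : CondIndepViews P) (hYt : Measurable Yt)
    {f : X₁ → Bool} (hf : Measurable f) (b c y : Bool) :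
    P.real ({z | z.2 = y} ∩ ({z | f z.1.2 = b} ∩ {z | Yt z.1.1 = some c})) =
      P.real ({z | z.2 = y} ∩ {z | Yt z.1.1 = some c}) *
        (P[{z | f z.1.2 = b} | {z | z.2 = y}]).toReal := by
  have h1 := h y {x | Yt x = some c} {x | f x = b} (measurableSet_pseudolabel hYt _)
    (hf (measurableSet_singleton b))
  have hY := measurableSet_label (X₀ := X₀) (X₁ := X₁) y
  rw [Measure.real, Measure.real, ← ENNReal.toReal_mul, ← cond_mul_eq_inter hY,
    ← cond_mul_eq_inter hY, Set.inter_comm {z : (X₀ × X₁) × Bool | f z.1.2 = b}]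
  congr 1
  refine Eq.trans (congrArg (· * _) h1) ?_
  simp only [Set.mem_ofPred_eq]
  ring

/-- Complementation of `f`, weighted by the mass: without the weight it would fail for a label of
probability zero, where the conditional measure is zero. -/
theorem measureReal_inter_mul_cond (h : CondIndepViews P) (hYt : Measurable Yt)
    {f : X₁ → Bool} (hf : Measurable f) (b c y : Bool) :
    P.real ({z | z.2 = y} ∩ {z | Yt z.1.1 = some c}) *
        (P[{z | f z.1.2 = b} | {z | z.2 = y}]).toReal =
      P.real ({z | z.2 = y} ∩ {z | Yt z.1.1 = some c}) -
      P.real ({z | z.2 = y} ∩ {z | Yt z.1.1 = some c}) *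
        (P[{z | f z.1.2 = !b} | {z | z.2 = y}]).toReal := by
  rw [← measureReal_inter_of_condIndepViews h hYt hf, ← measureReal_inter_of_condIndepViews h hYt hf]
  have hm : MeasurableSet {z : (X₀ × X₁) × Bool | f z.1.2 = b} :=
    (hf.comp (measurable_snd.comp measurable_fst)) (measurableSet_singleton b)
  rw [← measureReal_inter_add_sdiff (s := {z | z.2 = y} ∩ {z | Yt z.1.1 = some c}) hm, eq_sub_iff_add_eq]
  congr 2
  · ext z; simp only [Set.mem_inter_iff, Set.mem_ofPred_eq]; tauto
  · ext z
    simp only [Set.mem_inter_iff, Set.mem_sdiff, Set.mem_ofPred_eq, Bool.eq_not]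
    tauto

omit [IsProbabilityMeasure P] in
theorem labelErrorRate_eq (hYt : Measurable Yt) (y' y : Bool) :
    labelErrorRate P Yt y' y = P.real ({z | z.2 = y'} ∩ {z | Yt z.1.1 = some y}) /
      P.real {z | Yt z.1.1 = some y} := by
  rw [labelErrorRate, cond_apply (measurableSet_fst_pseudolabel hYt _), ENNReal.toReal_mul,
    ENNReal.toReal_inv, Set.inter_comm, div_eq_inv_mul]
  rfl

/-- With `e₁`, `e₀` the errors of `f` given `Y = 1` and `Y = 0`, twice the left side is `(1 - α) *
e₁ + α * (1 - e₀) + (1 - γ) * e₀ + γ * (1 - e₁)`. Balancing is what makes `e₁` and `e₀` appear with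
the same coefficient. -/
theorem pseudoBalancedError_eq (h : CondIndepViews P) (hYt : Measurable Yt)
    (hpos : ∀ y : Bool, 0 < P {z | Yt z.1.1 = some y}) {f : X₁ → Bool} (hf : Measurable f) :
    pseudoBalancedError P Yt f =
      (1 - labelErrorRate P Yt false true - labelErrorRate P Yt true false) * balancedError P f +
        (labelErrorRate P Yt false true + labelErrorRate P Yt true false) / 2 := by
  have hp : ∀ y, P.real {z | Yt z.1.1 = some y} ≠ 0 := fun y =>
    (ENNReal.toReal_pos (hpos y).ne' (measure_ne_top _ _)).ne'
  have h1 := hp true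
  have h0 := hp false
  have e1 := measureReal_inter_label (P := P) {z | Yt z.1.1 = some true}
  have e0 := measureReal_inter_label (P := P) {z | Yt z.1.1 = some false}
  have c1 := measureReal_inter_mul_cond h hYt hf false true false
  have c0 := measureReal_inter_mul_cond h hYt hf true false true
  rw [pseudoBalancedError, balancedError, labelErrorRate_eq hYt, labelErrorRate_eq hYt,
    ← measureReal_inter_label ({z | f z.1.2 = false} ∩ _),
    ← measureReal_inter_label ({z | f z.1.2 = true} ∩ _)]
  simp only [measureReal_inter_of_condIndepViews h hYt hf]
  -- The mislabeled parts are rewritten through the complementary prediction, so that only the two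
  -- errors in `balancedError` remain.
  rw [c1, c0]
  simp only [Bool.not_true, Bool.not_false]
  rw [← e1] at h1 ⊢
  rw [← e0] at h0 ⊢
  field_simp
  ring

theorem coverage_mul_coveredClassProb (hYt : Measurable Yt) (y : Bool) :
    coverage P Yt * coveredClassProb P Yt y = P.real {z | Yt z.1.1 = some y} := by
  have hm : MeasurableSet {z : (X₀ × X₁) × Bool | Yt z.1.1 ≠ none} :=
    (measurableSet_fst_pseudolabel hYt none).compl
  rw [coverage, coveredClassProb, mul_comm, ← ENNReal.toReal_mul, cond_mul_eq_inter hm]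
  congr 2
  ext z
  simp only [Set.mem_inter_iff, Set.mem_ofPred_eq, and_iff_right_iff_imp]
  intro h
  simp [h]

end Noise

/-! ### Refined samples and the excess risk -/

section Selection

variable {X₀ X₁ : Type*} [MeasurableSpace X₀] [MeasurableSpace X₁]

omit [MeasurableSpace X₁] in
theorem measurable_refinedLabel (S : ScoringRule X₀) {Yhat : X₀ → Pseudolabel}
    (hY : Measurable Yhat) {m : ℕ} (r : Fin m → X₀ × X₁) (τ : ℝ) :
    Measurable (refinedLabel S Yhat r τ) := by
  have h : Measurable (insertedScore S Yhat r) := by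
    refine (S.measurable_score (m + 1) 0).comp (measurable_pi_iff.2 fun i => ?_)
    refine Fin.cases ?_ (fun j => ?_) i
    · exact measurable_id.prodMk hY
    · exact measurable_const
  exact Measurable.ite (measurableSet_le h measurable_const) hY measurable_const

theorem iid_pseudolabeled_sample (μ : Measure (X₀ × X₁)) [IsProbabilityMeasure μ]
    {Yt : X₀ → Pseudolabel} (hYt : Measurable Yt) (n : ℕ) :
    iIndepFun (fun (i : Fin n) (s : Fin n → X₀ × X₁) => (s i, Yt (s i).1))
        (Measure.pi fun _ => μ) ∧
      ∀ i : Fin n, (Measure.pi fun _ : Fin n => μ).map (fun s => (s i, Yt (s i).1)) =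
        μ.map fun x => (x, Yt x.1) := by
  have hm : Measurable fun x : X₀ × X₁ => (x, Yt x.1) :=
    measurable_id.prodMk (hYt.comp measurable_fst)
  refine ⟨iIndepFun_pi (X := fun _ (x : X₀ × X₁) => (x, Yt x.1)) fun _ => hm.aemeasurable, fun i => ?_⟩
  have h := (measurePreserving_eval (fun _ : Fin n => μ) i).map_eq
  conv_rhs => rw [← h]
  rw [Measure.map_map hm (measurable_pi_apply i)]
  rfl

/-- The points with pseudolabel `y`. -/
def pseudolabelSet (X₁ : Type*) (Yt : X₀ → Pseudolabel) (y : Bool) : Set (X₀ × X₁) :=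
  {x | Yt x.1 = some y}

/-- The number of sample points with pseudolabel `y`. -/
noncomputable def labelCount {n : ℕ} (Yt : X₀ → Pseudolabel) (s : Fin n → X₀ × X₁) (y : Bool) : ℝ :=
  ∑ i, hit Prod.snd (pseudolabelSet X₁ Yt y) true (fun _ => true) (s i)

/-- The number of sample points with pseudolabel `y` on which `f` takes the other value. -/
noncomputable def errorCount {n : ℕ} (Yt : X₀ → Pseudolabel) (s : Fin n → X₀ × X₁) (y : Bool)
    (f : X₁ → Bool) : ℝ :=
  ∑ i, hit Prod.snd (pseudolabelSet X₁ Yt y) (!y) f (s i)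

omit [MeasurableSpace X₀] [MeasurableSpace X₁] in
theorem empBalancedError_eq {n : ℕ} (Yt : X₀ → Pseudolabel) (s : Fin n → X₀ × X₁)
    (f : X₁ → Bool) : empBalancedError Yt s f =
      (errorCount Yt s true f / labelCount Yt s true +
        errorCount Yt s false f / labelCount Yt s false) / 2 := by
  have h1 : ∀ y, labelCount Yt s y = ∑ i, if Yt (s i).1 = some y then (1 : ℝ) else 0 := by
    intro y
    refine Finset.sum_congr rfl fun i _ => ?_
    by_cases h : Yt (s i).1 = some y <;> simp [hit, pseudolabelSet, h]
  have h2 : ∀ y, errorCount Yt s y f =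
      ∑ i, if f (s i).2 = !y ∧ Yt (s i).1 = some y then (1 : ℝ) else 0 := by
    intro y
    refine Finset.sum_congr rfl fun i _ => ?_
    by_cases h : Yt (s i).1 = some y <;> by_cases h' : f (s i).2 = !y <;>
      simp [hit, pseudolabelSet, h, h']
  rw [empBalancedError, h1, h1, h2, h2]
  rfl

variable {P : Measure ((X₀ × X₁) × Bool)} [IsProbabilityMeasure P] {Yt : X₀ → Pseudolabel}

theorem measurableSet_pseudolabelSet (hYt : Measurable Yt) (y : Bool) :
    MeasurableSet (pseudolabelSet X₁ Yt y) :=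
  measurable_fst (measurableSet_pseudolabel hYt _)

omit [IsProbabilityMeasure P] in
theorem fst_real_pseudolabelSet (hYt : Measurable Yt) (y : Bool) :
    P.fst.real (pseudolabelSet X₁ Yt y) = P.real {z | Yt z.1.1 = some y} := by
  rw [Measure.real, Measure.fst_apply (measurableSet_pseudolabelSet hYt y)]
  rfl

omit [IsProbabilityMeasure P] in
theorem integral_hit_pseudolabel (hYt : Measurable Yt) {f : X₁ → Bool} (hf : Measurable f)
    (b y : Bool) : ∫ z, hit Prod.snd (pseudolabelSet X₁ Yt y) b f z ∂P.fst =
      P.real ({z | f z.1.2 = b} ∩ {z | Yt z.1.1 = some y}) := by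
  have hW : MeasurableSet (pseudolabelSet X₁ Yt y) :=
    measurableSet_pseudolabelSet hYt y
  rw [integral_hit measurable_snd hW hf, Measure.real,
    Measure.fst_apply (MeasurableSet.inter (s₁ := {z : X₀ × X₁ | f z.2 = b})
      ((hf.comp measurable_snd) (measurableSet_singleton b)) hW)]
  rfl

/-- Outside of four events of probability at most `δ / 4`, all label counts and error counts are
close to their means. -/
theorem measure_count_deviation_le (hYt : Measurable Yt) {F : Set (X₁ → Bool)} {d n : ℕ}
    (hd1 : 1 ≤ d) (hn : 0 < n) (hd : ∀ A : Finset X₁, ShattersSet F A → A.card ≤ d)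
    (hF : MeasurableClass (P.map fun z => z.1.2) F) {δ : ℝ} (hδ : 0 < δ) (hδ1 : δ < 1)
    (hL : ∀ y, 1024 * complexity d n δ ≤ n * P.real {z | Yt z.1.1 = some y}) :
    (Measure.pi fun _ : Fin n => P.fst)
      {s | ¬ ∀ y, |labelCount Yt s y - n * P.real {z | Yt z.1.1 = some y}| ≤
          16 * √(n * P.real {z | Yt z.1.1 = some y} * complexity d n δ) ∧
        ∀ f ∈ F, |errorCount Yt s y f -
            n * P.real ({z | f z.1.2 = !y} ∩ {z | Yt z.1.1 = some y})| ≤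
          16 * √(n * P.real {z | Yt z.1.1 = some y} * complexity d n δ)} ≤
      ENNReal.ofReal δ := by
  have hFs : MeasurableClass (P.fst.map Prod.snd) F := by
    rwa [Measure.fst, Measure.map_map measurable_snd measurable_fst]
  set ρ := Measure.pi fun _ : Fin n => P.fst
  have hW (y : Bool) : MeasurableSet (pseudolabelSet X₁ Yt y) :=
    measurableSet_pseudolabelSet hYt y
  set B₁ : Bool → Set (Fin n → X₀ × X₁) := fun y =>
    {s | ∃ f ∈ F, 16 * √(n * P.fst.real (pseudolabelSet X₁ Yt y) * complexity d n δ) <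
      |∑ i, hit Prod.snd (pseudolabelSet X₁ Yt y) (!y) f (s i) -
        n * ∫ z, hit Prod.snd (pseudolabelSet X₁ Yt y) (!y) f z ∂P.fst|}
  -- Label counts are the hits of the constant classifier `true`.
  set B₂ : Bool → Set (Fin n → X₀ × X₁) := fun y =>
    {s | ∃ f ∈ ({fun _ => true} : Set (X₁ → Bool)),
      16 * √(n * P.fst.real (pseudolabelSet X₁ Yt y) * complexity d n δ) <
      |∑ i, hit Prod.snd (pseudolabelSet X₁ Yt y) true f (s i) -
        n * ∫ z, hit Prod.snd (pseudolabelSet X₁ Yt y) true f z ∂P.fst|}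
  have hB₁ (y : Bool) : ρ (B₁ y) ≤ ENNReal.ofReal (δ / 4) :=
    measure_uniform_deviation_le_quarter hd1 hn hd measurable_snd (hW y) hFs hδ hδ1
      (by rw [fst_real_pseudolabelSet hYt]; exact hL y)
  have hB₂ (y : Bool) : ρ (B₂ y) ≤ ENNReal.ofReal (δ / 4) :=
    measure_uniform_deviation_le_quarter hd1 hn
      (fun A hA => (card_le_of_shattersSet_singleton _ A hA).trans (Nat.zero_le d))
      measurable_snd (hW y) (measurableClass_const _ true) hδ hδ1
      (by rw [fst_real_pseudolabelSet hYt]; exact hL y)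
  refine (measure_mono (t := (B₁ true ∪ B₂ true) ∪ (B₁ false ∪ B₂ false)) ?_).trans ?_
  · intro s hs
    simp only [Set.mem_ofPred_eq, not_forall] at hs
    obtain ⟨y, hy⟩ := hs
    have hmem : s ∈ B₁ y ∪ B₂ y := by
      rw [not_and_or] at hy
      rcases hy with hy | hy
      · refine Or.inr ⟨_, rfl, ?_⟩
        rw [integral_hit_pseudolabel hYt measurable_const, fst_real_pseudolabelSet hYt]
        simpa [labelCount] using hy
      · push Not at hy
        obtain ⟨f, hf, hy⟩ := hy
        refine Or.inl ⟨f, hf, ?_⟩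
        rw [integral_hit_pseudolabel hYt (hF.1 f hf), fst_real_pseudolabelSet hYt]
        exact hy
    cases y
    · exact Or.inr hmem
    · exact Or.inl hmem
  · have h4 : ENNReal.ofReal δ = (ENNReal.ofReal (δ / 4) + ENNReal.ofReal (δ / 4)) +
        (ENNReal.ofReal (δ / 4) + ENNReal.ofReal (δ / 4)) := by
      rw [← ENNReal.ofReal_add (by positivity) (by positivity),
        ← ENNReal.ofReal_add (by positivity) (by positivity)]
      congr 1; ring
    rw [h4]
    exact (measure_union_le _ _).trans (add_le_add
      ((measure_union_le _ _).trans (add_le_add (hB₁ _) (hB₂ _)))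
      ((measure_union_le _ _).trans (add_le_add (hB₁ _) (hB₂ _))))

theorem balancedError_nonneg (P : Measure ((X₀ × X₁) × Bool)) (f : X₁ → Bool) :
    0 ≤ balancedError P f := by
  unfold balancedError; positivity

theorem balancedError_le_one (f : X₁ → Bool) : balancedError P f ≤ 1 := by
  have h (A B : Set ((X₀ × X₁) × Bool)) : (P[A | B]).toReal ≤ 1 := by
    by_cases hB : P B = 0
    · simp [cond_eq_zero_of_meas_eq_zero hB]
    · have := cond_isProbabilityMeasure hB
      exact prob_le_one.trans_eq' (by rfl) |> ENNReal.toReal_mono (by simp) |>.trans (by simp)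
  unfold balancedError
  linarith [h {z | f z.1.2 = false} {z | z.2 = true}, h {z | f z.1.2 = true} {z | z.2 = false}]

/-- Uniform closeness of the empirical balanced error to its expectation. -/
theorem abs_empBalancedError_sub_le {n : ℕ} {L p : ℝ} (hL : 0 < L) (hn : 0 < n) (hp : 0 < p)
    (hpL : 1024 * L ≤ n * p) (hpy : ∀ y, p ≤ P.real {z | Yt z.1.1 = some y})
    {s : Fin n → X₀ × X₁} {f : X₁ → Bool}
    (h : ∀ y, |labelCount Yt s y - n * P.real {z | Yt z.1.1 = some y}| ≤
          16 * √(n * P.real {z | Yt z.1.1 = some y} * L) ∧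
        |errorCount Yt s y f - n * P.real ({z | f z.1.2 = !y} ∩ {z | Yt z.1.1 = some y})| ≤
          16 * √(n * P.real {z | Yt z.1.1 = some y} * L)) :
    |empBalancedError Yt s f - pseudoBalancedError P Yt f| ≤ 64 * √(L / (n * p)) := by
  have hn' : (0 : ℝ) < n := by exact_mod_cast hn
  have key (y : Bool) : |errorCount Yt s y f / labelCount Yt s y -
      P.real ({z | f z.1.2 = !y} ∩ {z | Yt z.1.1 = some y}) / P.real {z | Yt z.1.1 = some y}| ≤
      64 * √(L / (n * p)) := by
    obtain ⟨h1, h2⟩ := h y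
    have hpy := hpy y
    set w := P.real {z | Yt z.1.1 = some y}
    set v := P.real ({z | f z.1.2 = !y} ∩ {z | Yt z.1.1 = some y})
    have hw : 0 < w := hp.trans_le hpy
    have hvw : v ≤ w := measureReal_mono Set.inter_subset_right
    have hq : 0 < n * w := by positivity
    have hqL : 1024 * L ≤ n * w := hpL.trans (by gcongr)
    -- Thus the deviation `16 * √(n * w * L)` is at most half of the expected label count, as
    -- `abs_div_sub_le` requires.
    have hle : √(n * w * L) ≤ n * w / 32 := by
      rw [← Real.sqrt_sq (show 0 ≤ n * w / 32 by positivity)]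
      refine Real.sqrt_le_sqrt ?_
      nlinarith
    have e : n * v = n * w * (v / w) := by field_simp
    rw [e] at h2
    refine (abs_div_sub_le (by positivity) (div_le_one_of_le₀ hvw hw.le) hq h2 h1
      (by linarith)).trans ?_
    have e2 : √(n * w * L) / (n * w) = √(L / (n * w)) := by
      rw [show L / (n * w) = (n * w * L) / (n * w) ^ 2 by field_simp,
        Real.sqrt_div (by positivity), Real.sqrt_sq hq.le]
    calc _ = 64 * (√(n * w * L) / (n * w)) := by ring
      _ = 64 * √(L / (n * w)) := by rw [e2]
      _ ≤ _ := by gcongr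
  have k1 := abs_le.1 (key true)
  have k0 := abs_le.1 (key false)
  simp only [Bool.not_true, Bool.not_false] at k1 k0
  rw [empBalancedError_eq, pseudoBalancedError, abs_le]
  constructor <;> linarith [k1.1, k1.2, k0.1, k0.2]

theorem excessRiskRate_eq (hYt : Measurable Yt) (d n : ℕ) (δ : ℝ) :
    excessRiskRate P Yt d n δ =
      1 / (1 - labelErrorRate P Yt false true - labelErrorRate P Yt true false) *
        √(complexity d n δ / (n *
          min (P.real {z | Yt z.1.1 = some false}) (P.real {z | Yt z.1.1 = some true}))) := by
  rw [excessRiskRate, mul_assoc (n : ℝ), mul_min_of_nonneg _ _ (by unfold coverage; positivity),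
    coverage_mul_coveredClassProb hYt, coverage_mul_coveredClassProb hYt, complexity]

/-- On the event of uniform closeness, comparing an empirical minimizer with any `g` in `F` costs
the deviation `64 * √(L / (n * p))` twice, whence `128`; dividing by `κ` returns to the true labels.
Dimension 0 and small `n * p` are settled deterministically. -/
theorem measure_excessRisk_le (h : CondIndepViews P) (hYt : Measurable Yt) {F : Set (X₁ → Bool)}
    {d n : ℕ} (hn : 0 < n) (hd : ∀ A : Finset X₁, ShattersSet F A → A.card ≤ d)
    (hF : MeasurableClass (P.map fun z => z.1.2) F)
    (hpos : ∀ y : Bool, 0 < P {z | Yt z.1.1 = some y})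
    (hnoise : labelErrorRate P Yt false true + labelErrorRate P Yt true false < 1)
    {δ : ℝ} (hδ : 0 < δ) (hδ1 : δ < 1) :
    (Measure.pi fun _ : Fin n => P.fst)
      {s | ∃ f, IsEmpMinimizer F Yt s f ∧
        128 * excessRiskRate P Yt d n δ < balancedError P f - ⨅ g : F, balancedError P g} ≤
      ENNReal.ofReal δ := by
  have hn' : (0 : ℝ) < n := by exact_mod_cast hn
  have hp : ∀ y, 0 < P.real {z | Yt z.1.1 = some y} := fun y =>
    ENNReal.toReal_pos (hpos y).ne' (measure_ne_top _ _)
  have hα0 : 0 ≤ labelErrorRate P Yt false true := by unfold labelErrorRate; positivity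
  have hγ0 : 0 ≤ labelErrorRate P Yt true false := by unfold labelErrorRate; positivity
  set p := min (P.real {z | Yt z.1.1 = some false}) (P.real {z | Yt z.1.1 = some true}) with hpdef
  have hp0 : 0 < p := lt_min (hp _) (hp _)
  have hpy : ∀ y, p ≤ P.real {z | Yt z.1.1 = some y} := by
    intro y; cases y
    · exact min_le_left _ _
    · exact min_le_right _ _
  rw [excessRiskRate_eq hYt, ← hpdef]
  set κ := 1 - labelErrorRate P Yt false true - labelErrorRate P Yt true false with hκ
  have hκ0 : 0 < κ := by linarith
  have hκ1 : κ ≤ 1 := by linarith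
  have hR : 0 ≤ 128 * (1 / κ * √(complexity d n δ / (n * p))) := by positivity
  have excess {f : X₁ → Bool} {K : ℝ} (hf : f ∈ F)
      (hfg : ∀ g ∈ F, balancedError P f - balancedError P g ≤ K) :
      balancedError P f - ⨅ g : F, balancedError P g ≤ K := by
    have : Nonempty F := ⟨⟨f, hf⟩⟩
    have := le_ciInf (f := fun g : F => balancedError P g) (c := balancedError P f - K)
      fun g => by linarith [hfg g g.2]
    linarith
  have empty {A : Set (Fin n → X₀ × X₁)} (hA : ∀ s, s ∉ A) :
      (Measure.pi fun _ : Fin n => P.fst) A ≤ ENNReal.ofReal δ := by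
    rw [Set.eq_empty_iff_forall_notMem.2 hA]; simp
  rcases Nat.eq_zero_or_pos d with rfl | hd1
  · refine empty ?_
    rintro s ⟨f, hf, hlt⟩
    refine absurd (excess hf.1 fun g hg => ?_) (not_le.2 hlt)
    rw [subsingleton_of_vcDimension_eq_zero hd hf.1 hg, sub_self]
    exact hR
  have hL0 : 0 < complexity d n δ := by linarith [(complexity_bounds hd1 hn hδ hδ1).1]
  set L := complexity d n δ with hLdef
  rcases lt_or_ge (n * p) (1024 * L) with hsmall | hlarge
  · refine empty ?_
    rintro s ⟨f, hf, hlt⟩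
    refine absurd (excess hf.1 fun g hg => ?_) (not_le.2 hlt)
    -- In this regime the bound is at least `128 / 32 = 4`, while balanced errors lie in `[0, 1]`.
    have h1 : (1 / 32 : ℝ) ≤ √(L / (n * p)) := by
      refine Real.le_sqrt_of_sq_le ?_
      rw [le_div_iff₀ (by positivity)]
      linarith
    have h2 : 1 ≤ 1 / κ := by rwa [le_div_iff₀ hκ0, one_mul]
    have h3 : 1 * (1 / 32) ≤ 1 / κ * √(L / (n * p)) := by gcongr
    linarith [balancedError_le_one (P := P) f, balancedError_nonneg P g]
  · refine (measure_mono ?_).trans (measure_count_deviation_le (P := P) hYt hd1 hn hd hF hδ hδ1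
      fun y => hlarge.trans (by gcongr; exact hpy y))
    rintro s ⟨f, hf, hlt⟩ hgood
    refine absurd (excess hf.1 fun g hg => ?_) (not_le.2 hlt)
    have dev {f : X₁ → Bool} (hf : f ∈ F) :=
      abs_le.1 (abs_empBalancedError_sub_le (f := f) hL0 hn hp0 hlarge hpy fun y =>
        ⟨(hgood y).1, (hgood y).2 f hf⟩)
    have h1 := (dev hf.1).1
    have h2 := (dev hg).2
    have h3 := hf.2 g hg
    rw [pseudoBalancedError_eq h hYt hpos (hF.1 _ hf.1), ← hκ] at h1
    rw [pseudoBalancedError_eq h hYt hpos (hF.1 _ hg), ← hκ] at h2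
    -- The additive noise term cancels in the difference of pseudolabel errors, leaving `κ` times
    -- the difference of true errors.
    rw [← mul_assoc, mul_one_div, div_mul_eq_mul_div, le_div_iff₀ hκ0]
    nlinarith

theorem selectionGuarantee (h : CondIndepViews P) {Yhat : X₀ → Pseudolabel}
    (hY : Measurable Yhat) {F : Set (X₁ → Bool)}
    (hF : MeasurableClass (P.map fun z => z.1.2) F) (hvc : vcDimension F ≠ ⊤)
    (S : ScoringRule X₀) : SelectionGuarantee 128 P F Yhat S := by
  rintro m r β τ - - - n hn Yt rfl
  have hYt := measurable_refinedLabel S hY r τ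
  exact ⟨iid_pseudolabeled_sample P.fst hYt n, fun hpos hnoise δ hδ hδ1 =>
    measure_excessRisk_le h hYt hn (card_le_vcDimension hvc) hF hpos hnoise hδ hδ1⟩

end Selection

theorem mainTheorem3 :
    ∃ C : ℝ, 0 < C ∧
      ∀ (X₀ : Type u) (X₁ : Type v) [MeasurableSpace X₀] [MeasurableSpace X₁]
        (P : Measure ((X₀ × X₁) × Bool)) [IsProbabilityMeasure P]
        (F : Set (X₁ → Bool)) (Yhat : X₀ → Pseudolabel),
        CondIndepViews P → Measurable Yhat →
        MeasurableClass (P.map fun z => z.1.2) F → vcDimension F ≠ ⊤ →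
        (∀ S : ScoringRule X₀, SelectionGuarantee C P F Yhat S) ∧
          ∀ (D : ℕ) (φ : X₀ → EuclideanSpace ℝ (Fin D)) (hφ : Measurable φ) (K : ℕ),
            SelectionGuarantee C P F Yhat (cutStatistic φ hφ K) :=
  ⟨128, by norm_num, fun _ _ _ _ _ _ _ _ h hY hF hvc =>
    ⟨fun S => selectionGuarantee h hY hF hvc S,
      fun _ _ hφ K => selectionGuarantee h hY hF hvc (cutStatistic _ hφ K)⟩⟩
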